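/- **Theorem (First Periodic Solution in Thomas).** For $n\in\mathbb N_0$ put $\alpha_0=1$ and $\alpha_n=2$ for $n\ge1$. For $\tau>0$ let $\ell^1_\tau(\mathbb N_0)$ be the space of real sequences $U=(U_n)_{n\ge0}$ with $\|U\|_{1,\tau}=\sum_{n\ge0}\alpha_n|U_n|\tau^n<\infty$, and let $\ell^1_{e,\tau}=\ell^1_\tau(\mathbb N_0)\times\ell^1_\tau(\mathbb N_0)$ with norm $\|\mathbf U\|_{1,\tau}=\|U_1\|_{1,\tau}+\|U_2\|_{1,\tau}$. A sequence $U$ represents the even $2d$-periodic function $\sum_n\alpha_nU_n\cos(\pi nx/d)$; accordingly $(U*V)_n=\sum_{k\in\mathbb Z}U_{|n-k|}V_{|k|}$, $(\Delta U)_n=-(\pi n/d)^2U_n$, and constants stand for multiples of the unit $e_0=(1,0,0,\dots)$ of the convolution algebra $\ell^1_\tau(\mathbb N_0)$. Let $$F_p(\mathbf U)=\begin{pmatrix}\nu\Delta U_1-U_1+\nu_4-\big(\nu_1\nu\,U_1*U_1-\nu_1U_1*U_2\big)*\big(1+U_1+\nu_2U_1*U_1\big)^{-1}\\ \Delta U_2-\nu_3U_2+(\nu_3\nu-1)U_1-\nu_3\nu_5+\nu_4\end{pmatrix},$$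 where the inverse is taken in the convolution algebra $\ell^1_\tau(\mathbb N_0)$. Take $\nu=0.1764$, $\nu_1=8$, $\nu_2=1$, $\nu_3=0.28$, $\nu_4=21$, $\nu_5=67.46981860371494$, $d=5$, $\tau=1.01$ and $R=5\times10^{-9}$. Let $\widehat{\mathbf U}=(\widehat U_1,\widehat U_2)$ have the following entries, all other entries being $0$: $$\begin{array}{r|r|r} n&(\widehat U_1)_n&(\widehat U_2)_n\\ \hline 0&5.816734553510635&-12.217798605299359\\ 3&0.230392933315547&-0.057138031644770\\ 6&-0.006831793543855&0.000448126854588\\ 9&0.000220538873028&-0.000006499136583\\ 12&-0.000008112591562&0.000000134991074\\ 15&0.000000324772264&-0.000000003464745\\ 18&-0.000000013663755&0.000000000101325\\ 21&0.000000000588158&-0.000000000003206\\ 24&-0.000000000025265&0.000000000000105\\ 27&0.000000000001050&-0.000000000000003\end{array}$$ For $\sigma\in\{1,-1\}$ let $\widehat{\mathbf U}^{\sigma}$ be the sequence $(\sigma^n\widehat{\mathbf U}_n)_n$ ($\sigma=-1$ is the translation by half a period). Let $\overline{\mathbf U}\in\ell^1_{e,1.01}$ be any approximate solution with $\|\overline{\mathbf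 U}-\widehat{\mathbf U}^{\sigma}\|_{1,1.01}\le10^{-9}$ for some $\sigma\in\{1,-1\}$ (for instance $\overline{\mathbf U}=\widehat{\mathbf U}$). Then $1+U_1+\nu_2U_1*U_1$ is invertible in $\ell^1_{1.01}(\mathbb N_0)$ for every $\mathbf U$ in the closed ball $\overline{B_R(\overline{\mathbf U})}\subset\ell^1_{e,1.01}$, so that $F_p$ is defined on this ball, and there is exactly one $\widetilde{\mathbf U}\in\overline{B_R(\overline{\mathbf U})}$ with $F_p(\widetilde{\mathbf U})=0$; in particular $\|\widetilde{\mathbf U}-\overline{\mathbf U}\|_{1,1.01}\le R$. -/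

import Mathlib

namespace Thomas

noncomputable section

/-- Real sequences indexed by the non-negative integers: the Fourier coefficients of an even
function `u(x) = ∑ n, α n * U n * cos (π n x / d)`. -/
abbrev Coeffs : Type := ℕ → ℝ

/-- The size of the orbit `{n, -n}`. -/
def alpha (n : ℕ) : ℝ := if n = 0 then 1 else 2

/-- Membership in the weighted space `ℓ¹_τ(ℕ₀)`. -/
def MemEll (τ : ℝ) (U : Coeffs) : Prop := Summable fun n => alpha n * |U n| * τ ^ n

/-- The norm of `ℓ¹_τ(ℕ₀)`. -/
def ellNorm (τ : ℝ) (U : Coeffs) : ℝ := ∑' n, alpha n * |U n| * τ ^ n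

/-- Membership in `ℓ¹_{e,τ} = ℓ¹_τ(ℕ₀) × ℓ¹_τ(ℕ₀)`. -/
def MemEllE (τ : ℝ) (U : Coeffs × Coeffs) : Prop := MemEll τ U.1 ∧ MemEll τ U.2

/-- The norm of `ℓ¹_{e,τ}`. -/
def ellENorm (τ : ℝ) (U : Coeffs × Coeffs) : ℝ := ellNorm τ U.1 + ellNorm τ U.2

/-- The closed ball of radius `r` about `C` in `ℓ¹_{e,τ}`. -/
def closedBallE (τ : ℝ) (C : Coeffs × Coeffs) (r : ℝ) : Set (Coeffs × Coeffs) :=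
  {U | MemEllE τ U ∧ ellENorm τ (U - C) ≤ r}

/-- The coefficients of the constant function `1`. -/
def e0 : Coeffs := fun n => if n = 0 then 1 else 0

/-- Discrete convolution of the even extensions `k ↦ U |k|`, `k ↦ V |k|` to `ℤ`: the coefficients
of the product of the two functions. -/
def conv (U V : Coeffs) : Coeffs := fun n => ∑' k : ℤ, U ((n : ℤ) - k).natAbs * V k.natAbs

/-- `Ψ` is an inverse of `Φ` for convolution, inside `ℓ¹_τ(ℕ₀)`. -/
def IsConvInv (τ : ℝ) (Φ Ψ : Coeffs) : Prop := MemEll τ Ψ ∧ conv Φ Ψ = e0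

/-- `Φ` is invertible in the algebra `ℓ¹_τ(ℕ₀)`. -/
def ConvInvertible (τ : ℝ) (Φ : Coeffs) : Prop := ∃ Ψ, IsConvInv τ Φ Ψ

open Classical in
/-- The inverse of `Φ` in the algebra `ℓ¹_τ(ℕ₀)` (only meaningful for invertible `Φ`). -/
def convInv (τ : ℝ) (Φ : Coeffs) : Coeffs :=
  if h : ConvInvertible τ Φ then h.choose else 0

/-- The second derivative on coefficients of even functions of period `2 d`: multiplication by
`-(2 π ñ)²` with `ñ = n / (2 d)`. -/
def lap (d : ℝ) (U : Coeffs) : Coeffs := fun n => -(2 * Real.pi * (n / (2 * d))) ^ 2 * U n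

/-- The parameters of the model, with the half-period `d` and the weight `τ`. -/
structure Params where
  (ν ν₁ ν₂ ν₃ ν₄ ν₅ d τ : ℝ)

/-- The denominator `1 + U₁ + ν₂ U₁²`. -/
def denom (p : Params) (U : Coeffs × Coeffs) : Coeffs := e0 + U.1 + p.ν₂ • conv U.1 U.1

/-- The numerator `ν₁ ν U₁² - ν₁ U₁ * U₂`. -/
def numer (p : Params) (U : Coeffs × Coeffs) : Coeffs :=
  (p.ν₁ * p.ν) • conv U.1 U.1 - p.ν₁ • conv U.1 U.2

/-- The nonlinearity `g_p(U) = ν₄ - (ν₁ ν U₁² - ν₁ U₁ * U₂) / (1 + U₁ + ν₂ U₁²)`. -/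
def gp (p : Params) (U : Coeffs × Coeffs) : Coeffs :=
  p.ν₄ • e0 - conv (numer p U) (convInv p.τ (denom p U))

/-- The linear part of the periodic zero-finding map. -/
def Lp (p : Params) (U : Coeffs × Coeffs) : Coeffs × Coeffs :=
  (p.ν • lap p.d U.1 - U.1,
    (p.ν₃ * p.ν - 1) • U.1 + (lap p.d U.2 - p.ν₃ • U.2))

/-- The nonlinear part of the periodic zero-finding map. -/
def Gp (p : Params) (U : Coeffs × Coeffs) : Coeffs × Coeffs :=
  (gp p U, (-p.ν₃ * p.ν₅ + p.ν₄) • e0)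

/-- The periodic zero-finding map `F_p = L_p + G_p`. -/
def Fp (p : Params) (U : Coeffs × Coeffs) : Coeffs × Coeffs := Lp p U + Gp p U

/-- The sequence with `c[k] * σ ^ (3 k)` at index `3 k` and zero elsewhere. -/
def ofThirds (σ : ℝ) (c : List ℝ) : Coeffs := fun n =>
  if n % 3 = 0 then σ ^ n * c.getD (n / 3) 0 else 0

/-- Coefficients number `0, 3, …, 27` of the first component of the approximate solution. -/
def centerList₁ : List ℝ :=
  [5.816734553510635, 0.230392933315547, -0.006831793543855, 0.000220538873028,
    -0.000008112591562, 0.000000324772264, -0.000000013663755, 0.000000000588158,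
    -0.000000000025265, 0.000000000001050]

/-- Coefficients number `0, 3, …, 27` of the second component of the approximate solution. -/
def centerList₂ : List ℝ :=
  [-12.217798605299359, -0.057138031644770, 0.000448126854588, -0.000006499136583,
    0.000000134991074, -0.000000003464745, 0.000000000101325, -0.000000000003206,
    0.000000000000105, -0.000000000000003]

/-- The approximate solution (`σ = 1`) and its translate by half a period (`σ = -1`). -/
def center (σ : ℝ) : Coeffs × Coeffs := (ofThirds σ centerList₁, ofThirds σ centerList₂)

end

end Thomas

/-! The second row of `F_p` is affine, and its linear part is diagonal and invertible in U₂, so its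
zeros are U₂ = S U₁ + κ with S diagonal with entries `muR n`. Dividing the first row by the factors
`lamR n` then turns F_p = 0 into one fixed point equation x = P(21 − q(x)) for x = U₁, where P is
diagonal with entries `(lamR n)⁻¹` and q is the quotient with U₂ eliminated (`Fp_eq_zero_iff`).
Everything takes place in the commutative Banach algebra `Ell τ`, complete because it is a weighted
ℓ¹.

The equation is solved by a quasi-Newton map x ↦ x − A(x − P(21 − q(x))). Here A differs from the
identity in ten columns and approximately inverts the linearization h ↦ h + P(a h + b S h). Since q
is rational, q(x) − q(y) has an exact divided-difference formula (`quot_sub_quot`), and no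
differentiation is needed. The map contracts by 1/2 on the ball of radius 1e-8 about a refined
centre u and moves u by at most 1e-10 (`norm_newton_sub_le`, `norm_newton_u_sub_le`). Banach's
theorem gives a fixed point within 2e-10 of u, the contraction gives uniqueness within 1e-8, and the
radius R with its 1e-9 tolerance lies between these scales.

The operator bounds come from column norms. Columns j < 19 are finite rational computations; in
later columns a and b, supported below index 10, cannot reach the modes that A alters, and the decay
of P suffices (`norm_linQ_single_le`). Half-period translation conjugates all the data by diag(σⁿ),
an isometry, so the same rational checks serve both signs. -/

namespace Thomas

noncomputable section

/-! ### Sums over the integers of even functions -/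

lemma alpha_mul_eq (g : ℕ → ℝ) :
    (fun n => alpha n * g n) = fun n => g n + g n - if n = 0 then g 0 else 0 := by
  funext n
  by_cases hn : n = 0
  · subst hn; simp [alpha]
  · simp [alpha, hn]; ring

lemma hasSum_natAbs {g : ℕ → ℝ} (hg : Summable g) :
    HasSum (fun k : ℤ => g k.natAbs) (∑' n, alpha n * g n) := by
  have h1 : HasSum (fun k : ℤ => g k.natAbs) (∑' n, g n + ∑' n, g n - g 0) := by
    simpa using HasSum.of_nat_of_neg (f := fun k : ℤ => g k.natAbs) (by simpa using hg.hasSum)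
      (by simpa using hg.hasSum)
  have h2 : HasSum (fun n => alpha n * g n) (∑' n, g n + ∑' n, g n - g 0) := by
    rw [alpha_mul_eq]
    exact (hg.hasSum.add hg.hasSum).sub (hasSum_ite_eq 0 (g 0))
  rwa [h2.tsum_eq]

lemma summable_alpha_mul_iff {g : ℕ → ℝ} :
    (Summable fun n => alpha n * g n) ↔ Summable g := by
  constructor
  · intro h
    refine (summable_nat_add_iff 1).1 ?_
    have := ((summable_nat_add_iff 1).2 h).mul_left (1 / 2)
    simpa [alpha] using this
  · intro h
    rw [alpha_mul_eq]
    exact (h.add h).sub (hasSum_ite_eq 0 (g 0)).summable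

lemma summable_natAbs_iff {g : ℕ → ℝ} :
    (Summable fun k : ℤ => g k.natAbs) ↔ Summable g := by
  refine ⟨fun h => ?_, fun h => (hasSum_natAbs h).summable⟩
  exact (h.comp_injective Nat.cast_injective).congr fun n => by simp

lemma memEll_iff {τ : ℝ} {U : Coeffs} : MemEll τ U ↔ Summable fun n => |U n| * τ ^ n := by
  unfold MemEll
  simp_rw [mul_assoc]
  exact summable_alpha_mul_iff

lemma memEll_iff_int {τ : ℝ} {U : Coeffs} :
    MemEll τ U ↔ Summable fun k : ℤ => |U k.natAbs| * τ ^ k.natAbs := by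
  rw [memEll_iff, ← summable_natAbs_iff (g := fun n => |U n| * τ ^ n)]

lemma ellNorm_eq_int {τ : ℝ} {U : Coeffs} (hU : MemEll τ U) :
    ellNorm τ U = ∑' k : ℤ, |U k.natAbs| * τ ^ k.natAbs := by
  rw [(hasSum_natAbs (memEll_iff.1 hU)).tsum_eq]
  simp only [ellNorm, mul_assoc]

lemma MemEll.summable_abs {τ : ℝ} (hτ : 1 ≤ τ) {U : Coeffs} (hU : MemEll τ U) :
    Summable fun k : ℤ => |U k.natAbs| := by
  refine Summable.of_nonneg_of_le (fun _ => abs_nonneg _) (fun k => ?_) (memEll_iff_int.1 hU)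
  exact le_mul_of_one_le_right (abs_nonneg _) (one_le_pow₀ hτ)

/-! ### Convolution -/

/-- Convolution on the integers. -/
def zconv (f g : ℤ → ℝ) (n : ℤ) : ℝ := ∑' k, f (n - k) * g k

/-- The shear (n, k) ↦ (n − k, k) is a bijection of ℤ², so this is summability of a product family.
-/
lemma summable_mul_shift {f g : ℤ → ℝ} (hf : Summable fun k => |f k|)
    (hg : Summable fun k => |g k|) :
    Summable fun p : ℤ × ℤ => |f (p.1 - p.2)| * |g p.2| := by
  have h := Summable.mul_of_nonneg hf hg (fun _ => abs_nonneg _) (fun _ => abs_nonneg _)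
  let e : ℤ × ℤ ≃ ℤ × ℤ := ⟨fun p => (p.1 - p.2, p.2), fun p => (p.1 + p.2, p.2),
    fun p => by simp, fun p => by simp⟩
  exact e.summable_iff.2 h

lemma summable_mul_shift_right {f g : ℤ → ℝ} (hf : Summable fun k => |f k|)
    (hg : Summable fun k => |g k|) (n : ℤ) : Summable fun k => f (n - k) * g k := by
  refine Summable.of_abs ?_
  simpa [abs_mul] using (summable_mul_shift hf hg).prod_factor n

lemma zconv_comm (f g : ℤ → ℝ) : zconv f g = zconv g f := by
  funext n
  rw [zconv, zconv, ← (Equiv.subLeft n).tsum_eq]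
  exact tsum_congr fun k => by simp [mul_comm]

lemma abs_le_tsum {h : ℤ → ℝ} (hh : Summable fun k => |h k|) (k : ℤ) : |h k| ≤ ∑' k, |h k| :=
  hh.le_tsum k fun _ _ => abs_nonneg _

lemma zconv_assoc {f g h : ℤ → ℝ} (hf : Summable fun k => |f k|) (hg : Summable fun k => |g k|)
    (hh : Summable fun k => |h k|) : zconv (zconv f g) h = zconv f (zconv g h) := by
  funext n
  have h1 : ∀ k, zconv f g (n - k) * h k = ∑' m, f (n - m) * (g (m - k) * h k) := by
    intro k
    rw [zconv, ← tsum_mul_right,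
      ← (Equiv.subRight k).tsum_eq (fun m => f (n - k - m) * g m * h k)]
    refine tsum_congr fun m => ?_
    rw [Equiv.subRight_apply, sub_sub_sub_cancel_right, mul_assoc]
  have h2 : ∀ m, f (n - m) * zconv g h m = ∑' k, f (n - m) * (g (m - k) * h k) := by
    intro m
    rw [zconv, tsum_mul_left]
  rw [zconv, zconv]
  simp_rw [h1, h2]
  refine Summable.tsum_comm (f := fun m k => f (n - m) * (g (m - k) * h k)) ?_
  refine Summable.of_abs ?_
  -- Domination for Fubini: f is bounded by its ℓ¹ norm, which leaves the summable sheared family of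
  -- g and h.
  refine Summable.of_nonneg_of_le (fun _ => abs_nonneg _) (fun p => ?_)
    ((summable_mul_shift hg hh).mul_left (∑' k, |f k|))
  simp only [Function.uncurry, abs_mul]
  gcongr
  exact abs_le_tsum hf _

lemma conv_eq_zconv (U V : Coeffs) (n : ℕ) :
    conv U V n = zconv (fun k => U k.natAbs) (fun k => V k.natAbs) n := rfl

/-- The reflection k ↦ −k preserves evenness under convolution, so iterated `conv` is iterated
`zconv` on ℤ. -/
lemma conv_natAbs (U V : Coeffs) (m : ℤ) :
    conv U V m.natAbs = zconv (fun k => U k.natAbs) (fun k => V k.natAbs) m := by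
  rw [conv_eq_zconv]
  rcases Int.natAbs_eq m with h | h
  · rw [← h]
  · rw [zconv, zconv, ← (Equiv.neg ℤ).tsum_eq]
    refine tsum_congr fun k => ?_
    simp only [Equiv.neg_apply, Int.natAbs_neg]
    have : ((m.natAbs : ℤ) - -k).natAbs = (m - k).natAbs := by omega
    rw [this]

lemma conv_comm (U V : Coeffs) : conv U V = conv V U := by
  funext n
  rw [conv_eq_zconv, zconv_comm, conv_eq_zconv]

variable {τ : ℝ} {U V W : Coeffs}

lemma conv_assoc (hτ : 1 ≤ τ) (hU : MemEll τ U) (hV : MemEll τ V) (hW : MemEll τ W) :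
    conv (conv U V) W = conv U (conv V W) := by
  funext n
  rw [conv_eq_zconv, conv_eq_zconv]
  simp_rw [conv_natAbs]
  rw [zconv_assoc (hU.summable_abs hτ) (hV.summable_abs hτ) (hW.summable_abs hτ)]

lemma conv_add (hτ : 1 ≤ τ) (hU : MemEll τ U) (hV : MemEll τ V) (hW : MemEll τ W) :
    conv U (V + W) = conv U V + conv U W := by
  funext n
  have h1 := summable_mul_shift_right (hU.summable_abs hτ) (hV.summable_abs hτ) n
  have h2 := summable_mul_shift_right (hU.summable_abs hτ) (hW.summable_abs hτ) n
  simp only [conv, Pi.add_apply, mul_add]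
  exact h1.tsum_add h2

lemma conv_smul (c : ℝ) (U V : Coeffs) : conv U (c • V) = c • conv U V := by
  funext n
  simp only [conv, Pi.smul_apply, smul_eq_mul, ← tsum_mul_left]
  exact tsum_congr fun k => by ring

lemma conv_zero (U : Coeffs) : conv U 0 = 0 := by
  funext n; simp [conv]

lemma conv_e0 (U : Coeffs) : conv U e0 = U := by
  funext n
  rw [conv, tsum_eq_single 0]
  · simp [e0]
  · intro k hk; simp [e0, hk]

lemma conv_summable_prod (hτ : 1 ≤ τ) (hU : MemEll τ U) (hV : MemEll τ V) :
    Summable fun p : ℤ × ℤ => |U (p.1 - p.2).natAbs| * τ ^ (p.1 - p.2).natAbs *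
      (|V p.2.natAbs| * τ ^ p.2.natAbs) := by
  have hτ0 : 0 ≤ τ := by linarith
  have := summable_mul_shift (f := fun k : ℤ => |U k.natAbs| * τ ^ k.natAbs)
      (g := fun k : ℤ => |V k.natAbs| * τ ^ k.natAbs)
      (by simpa [abs_mul, abs_of_nonneg hτ0] using memEll_iff_int.1 hU)
      (by simpa [abs_mul, abs_of_nonneg hτ0] using memEll_iff_int.1 hV)
  simpa [abs_mul, abs_of_nonneg hτ0] using this

/-- Since |n| ≤ |n − k| + |k| and τ ≥ 1, the weight is submultiplicative. -/
lemma conv_weight_le (hτ : 1 ≤ τ) (hU : MemEll τ U) (hV : MemEll τ V) (n : ℤ) :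
    |conv U V n.natAbs| * τ ^ n.natAbs ≤
      ∑' k : ℤ, |U (n - k).natAbs| * τ ^ (n - k).natAbs * (|V k.natAbs| * τ ^ k.natAbs) := by
  have hτ0 : 0 ≤ τ := by linarith
  have h0 := summable_mul_shift_right (hU.summable_abs hτ) (hV.summable_abs hτ) n
  have hs := (conv_summable_prod hτ hU hV).prod_factor n
  rw [conv_natAbs, zconv]
  have h1 : |∑' k : ℤ, U (n - k).natAbs * V k.natAbs| ≤
      ∑' k : ℤ, |U (n - k).natAbs * V k.natAbs| := norm_tsum_le_tsum_norm h0.norm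
  refine (mul_le_mul_of_nonneg_right h1 (pow_nonneg hτ0 _)).trans ?_
  rw [← tsum_mul_right]
  refine (h0.abs.mul_right _).tsum_le_tsum (fun k => ?_) hs
  rw [abs_mul, mul_mul_mul_comm, ← pow_add]
  refine mul_le_mul_of_nonneg_left (pow_le_pow_right₀ hτ ?_) (by positivity)
  omega

lemma MemEll.conv (hτ : 1 ≤ τ) (hU : MemEll τ U) (hV : MemEll τ V) : MemEll τ (conv U V) := by
  have hτ0 : 0 ≤ τ := by linarith
  exact memEll_iff_int.2 (Summable.of_nonneg_of_le (fun _ => by positivity)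
    (conv_weight_le hτ hU hV) (conv_summable_prod hτ hU hV).prod)

lemma ellNorm_conv_le (hτ : 1 ≤ τ) (hU : MemEll τ U) (hV : MemEll τ V) :
    ellNorm τ (conv U V) ≤ ellNorm τ U * ellNorm τ V := by
  have hs := conv_summable_prod hτ hU hV
  have hU' := memEll_iff_int.1 hU
  have hV' := memEll_iff_int.1 hV
  rw [ellNorm_eq_int (hU.conv hτ hV), ellNorm_eq_int hU, ellNorm_eq_int hV]
  calc _ ≤ ∑' n : ℤ, ∑' k : ℤ, |U (n - k).natAbs| * τ ^ (n - k).natAbs *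
        (|V k.natAbs| * τ ^ k.natAbs) :=
        (memEll_iff_int.1 (hU.conv hτ hV)).tsum_le_tsum (conv_weight_le hτ hU hV) hs.prod
    _ = ∑' k : ℤ, ∑' n : ℤ, |U (n - k).natAbs| * τ ^ (n - k).natAbs *
        (|V k.natAbs| * τ ^ k.natAbs) := (Summable.tsum_comm (f := fun n k : ℤ =>
          |U (n - k).natAbs| * τ ^ (n - k).natAbs * (|V k.natAbs| * τ ^ k.natAbs)) hs).symm
    _ = _ := by
      rw [← tsum_mul_left]
      refine tsum_congr fun k => ?_
      rw [tsum_mul_right, ← (Equiv.subRight k).tsum_eq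
        (fun m : ℤ => |U m.natAbs| * τ ^ m.natAbs)]
      rfl

/-! ### The Banach algebra -/

/-- The sequences of `ℓ¹_τ(ℕ₀)`, as a linear subspace. -/
def ellSubmodule (τ : ℝ) : Submodule ℝ Coeffs where
  carrier := {U | MemEll τ U}
  zero_mem' := by simp [MemEll]
  add_mem' := by
    intro U V hU hV
    simp only [Set.mem_ofPred_eq, memEll_iff] at hU hV ⊢
    refine Summable.of_abs (Summable.of_nonneg_of_le (fun _ => abs_nonneg _) (fun n => ?_)
      (hU.abs.add hV.abs))
    simp only [abs_mul, abs_abs, ← add_mul]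
    gcongr
    exact abs_add_le _ _
  smul_mem' := by
    intro c U hU
    simp only [Set.mem_ofPred_eq, memEll_iff] at hU ⊢
    simpa [abs_mul, mul_assoc] using hU.mul_left |c|

/-- The space `ℓ¹_τ(ℕ₀)`. -/
def Ell (τ : ℝ) : Type := ↥(ellSubmodule τ)

namespace Ell

instance : AddCommGroup (Ell τ) := inferInstanceAs (AddCommGroup (ellSubmodule τ))
instance : Module ℝ (Ell τ) := inferInstanceAs (Module ℝ (ellSubmodule τ))

/-- The underlying sequence. -/
def seq (u : Ell τ) : Coeffs := u.1

/-- The element with a given underlying sequence. -/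
def mk (U : Coeffs) (hU : MemEll τ U) : Ell τ := ⟨U, hU⟩

lemma memEll (u : Ell τ) : MemEll τ u.seq := u.2

@[simp] lemma seq_mk (U : Coeffs) (hU : MemEll τ U) : (mk U hU).seq = U := rfl

@[ext] lemma ext {u v : Ell τ} (h : u.seq = v.seq) : u = v := Subtype.ext h

@[simp] lemma seq_add (u v : Ell τ) : (u + v).seq = u.seq + v.seq := rfl
@[simp] lemma seq_sub (u v : Ell τ) : (u - v).seq = u.seq - v.seq := rfl
@[simp] lemma seq_zero : (0 : Ell τ).seq = 0 := rfl
@[simp] lemma seq_smul (c : ℝ) (u : Ell τ) : (c • u).seq = c • u.seq := rfl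

instance : Norm (Ell τ) := ⟨fun u => ellNorm τ u.seq⟩

lemma norm_def (u : Ell τ) : ‖u‖ = ellNorm τ u.seq := rfl

lemma hasSum_norm (u : Ell τ) : HasSum (fun n => |u.seq n| * (alpha n * τ ^ n)) ‖u‖ := by
  have := u.memEll.hasSum
  simp only [norm_def, ellNorm]
  convert this using 2
  ring

lemma memEll_e0 : MemEll τ e0 :=
  summable_of_ne_finset_zero (s := {0}) fun n hn => by
    have : n ≠ 0 := by simpa using hn
    simp [e0, this]

instance : One (Ell τ) := ⟨mk e0 memEll_e0⟩

lemma seq_one : (1 : Ell τ).seq = e0 := rfl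

lemma hasSum_norm_one : HasSum (fun n => |(1 : Ell τ).seq n| * (alpha n * τ ^ n)) 1 := by
  convert hasSum_ite_eq 0 (1 : ℝ) using 2 with n
  by_cases hn : n = 0
  · subst hn; simp [seq_one, e0, alpha]
  · simp [seq_one, e0, hn]

variable [hτ : Fact (1 ≤ τ)]

lemma one_le : 1 ≤ τ := hτ.out

lemma weight_pos (n : ℕ) : 0 < alpha n * τ ^ n := by
  have := hτ.out
  unfold alpha
  split_ifs <;> positivity

lemma normedSpaceCore : NormedSpace.Core ℝ (Ell τ) where
  norm_nonneg u := u.hasSum_norm.nonneg fun n => mul_nonneg (abs_nonneg _) (weight_pos n).le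
  norm_smul c u := by
    refine (c • u).hasSum_norm.unique ?_
    simpa [abs_mul, mul_assoc] using u.hasSum_norm.mul_left |c|
  norm_triangle u v := by
    refine hasSum_le (fun n => ?_) (u + v).hasSum_norm (u.hasSum_norm.add v.hasSum_norm)
    rw [← add_mul]
    exact mul_le_mul_of_nonneg_right (abs_add_le _ _) (weight_pos n).le
  norm_eq_zero_iff u := by
    constructor
    · intro h
      have h1 := u.hasSum_norm
      rw [h, hasSum_zero_iff_of_nonneg
        (fun n => mul_nonneg (abs_nonneg _) (weight_pos n).le)] at h1
      ext n
      have := congrFun h1 n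
      simpa [(weight_pos (τ := τ) n).ne'] using this
    · rintro rfl
      refine (0 : Ell τ).hasSum_norm.unique ?_
      simp

instance : NormedAddCommGroup (Ell τ) := NormedAddCommGroup.ofCore (𝕜 := ℝ) normedSpaceCore
instance : NormedSpace ℝ (Ell τ) := NormedSpace.ofCore normedSpaceCore

instance : Mul (Ell τ) := ⟨fun u v => mk (conv u.seq v.seq) (u.memEll.conv one_le v.memEll)⟩

lemma seq_mul (u v : Ell τ) : (u * v).seq = conv u.seq v.seq := rfl

instance : CommRing (Ell τ) :=
  { (inferInstance : AddCommGroup (Ell τ)) with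
    mul_assoc := fun u v w => ext (conv_assoc one_le u.memEll v.memEll w.memEll)
    one_mul := fun u => ext ((conv_comm _ _).trans (conv_e0 _))
    mul_one := fun u => ext (conv_e0 _)
    zero_mul := fun u => ext ((conv_comm _ _).trans (conv_zero _))
    mul_zero := fun u => ext (conv_zero _)
    mul_comm := fun u v => ext (conv_comm _ _)
    left_distrib := fun u v w => ext (conv_add one_le u.memEll v.memEll w.memEll)
    right_distrib := fun u v w => ext (by
      simp only [seq_mul, seq_add]
      rw [conv_comm, conv_add one_le w.memEll u.memEll v.memEll, conv_comm, conv_comm w.seq]) }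

instance : NormedCommRing (Ell τ) :=
  { (inferInstance : NormedAddCommGroup (Ell τ)), (inferInstance : CommRing (Ell τ)) with
    norm_mul_le := fun u v => ellNorm_conv_le one_le u.memEll v.memEll }

instance : Algebra ℝ (Ell τ) := Algebra.ofModule
  (fun c u v => ext (by
    simp only [seq_mul, seq_smul]; rw [conv_comm, conv_smul, conv_comm]))
  (fun c u v => ext (conv_smul c _ _))

instance : NormedAlgebra ℝ (Ell τ) where
  norm_smul_le c u := norm_smul_le c u

instance : NormOneClass (Ell τ) := ⟨(1 : Ell τ).hasSum_norm.unique hasSum_norm_one⟩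

/-- The equivalence with the unweighted `ℓ¹`. -/
def equivLp : Ell τ ≃ lp (fun _ : ℕ => ℝ) 1 where
  toFun u := ⟨fun n => u.seq n * (alpha n * τ ^ n), by
    change Memℓp _ 1
    rw [memℓp_gen_iff (by simp)]
    refine u.hasSum_norm.summable.congr fun n => ?_
    rw [Real.norm_eq_abs, abs_mul, abs_of_pos (weight_pos (τ := τ) n), ENNReal.toReal_one,
      Real.rpow_one]⟩
  invFun f := mk (fun n => f n / (alpha n * τ ^ n)) (by
    have h := (memℓp_gen_iff (by simp)).1 (lp.memℓp f)
    refine h.congr fun n => ?_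
    have := weight_pos (τ := τ) n
    rw [Real.norm_eq_abs, abs_div, abs_of_pos this, ENNReal.toReal_one, Real.rpow_one,
      mul_right_comm, mul_div_cancel₀ _ this.ne'])
  left_inv u := by
    ext n
    exact mul_div_cancel_right₀ _ (weight_pos (τ := τ) n).ne'
  right_inv f := by
    ext n
    exact div_mul_cancel₀ _ (weight_pos (τ := τ) n).ne'

lemma isometry_equivLp : Isometry (equivLp : Ell τ → lp (fun _ : ℕ => ℝ) 1) := by
  refine Isometry.of_dist_eq fun u v => ?_
  rw [dist_eq_norm, dist_eq_norm, lp.norm_eq_tsum_rpow (by simp), ← (u - v).hasSum_norm.tsum_eq]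
  simp only [ENNReal.toReal_one, div_one, Real.rpow_one]
  refine tsum_congr fun n => ?_
  rw [lp.coeFn_sub]
  change |u.seq n * (alpha n * τ ^ n) - v.seq n * (alpha n * τ ^ n)| = _
  rw [← sub_mul, abs_mul, abs_of_pos (weight_pos (τ := τ) n)]
  rfl

instance : CompleteSpace (Ell τ) :=
  (IsometryEquiv.mk equivLp isometry_equivLp).completeSpace

end Ell

end

end Thomas

namespace Thomas

noncomputable section

namespace Ell

variable {τ : ℝ} [hτ : Fact (1 ≤ τ)]

/-! ### Coordinates -/

lemma abs_seq_mul_weight_le (u : Ell τ) (n : ℕ) : |u.seq n| * (alpha n * τ ^ n) ≤ ‖u‖ :=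
  le_hasSum u.hasSum_norm n fun _ _ => mul_nonneg (abs_nonneg _) (weight_pos _).le

lemma one_le_weight (n : ℕ) : 1 ≤ alpha n * τ ^ n := by
  have h1 : 1 ≤ τ ^ n := one_le_pow₀ hτ.out
  unfold alpha
  split_ifs <;> linarith

lemma abs_seq_le (u : Ell τ) (n : ℕ) : |u.seq n| ≤ ‖u‖ :=
  (le_mul_of_one_le_right (abs_nonneg _) (one_le_weight n)).trans (u.abs_seq_mul_weight_le n)

/-- The coordinate functionals. -/
def coord (n : ℕ) : Ell τ →L[ℝ] ℝ :=
  LinearMap.mkContinuous ⟨⟨fun u => u.seq n, fun _ _ => rfl⟩, fun _ _ => rfl⟩ 1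
    fun u => (u.abs_seq_le n).trans_eq (one_mul _).symm

@[simp] lemma coord_apply (n : ℕ) (u : Ell τ) : coord n u = u.seq n := rfl

lemma seq_sum {ι : Type*} (s : Finset ι) (f : ι → Ell τ) (n : ℕ) :
    (∑ i ∈ s, f i).seq n = ∑ i ∈ s, (f i).seq n := map_sum (coord n) f s

/-- The sequence with a single entry `1`. -/
def single (j : ℕ) : Ell τ :=
  mk (fun n => if n = j then 1 else 0)
    (summable_of_ne_finset_zero (s := {j}) fun n hn => by
      have : n ≠ j := by simpa using hn
      simp [this])

omit hτ in
lemma seq_single (j n : ℕ) : (single j : Ell τ).seq n = if n = j then 1 else 0 := rfl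

omit hτ in
lemma norm_single (j : ℕ) : ‖(single j : Ell τ)‖ = alpha j * τ ^ j := by
  refine (single j : Ell τ).hasSum_norm.unique ?_
  convert hasSum_ite_eq j (alpha j * τ ^ j) using 2 with n
  rw [seq_single]
  split_ifs with h
  · subst h; simp
  · simp

lemma norm_smul_single (u : Ell τ) (j : ℕ) :
    ‖u.seq j • (single j : Ell τ)‖ = |u.seq j| * (alpha j * τ ^ j) := by
  rw [norm_smul, norm_single, Real.norm_eq_abs]

/-- The series converges absolutely, and the continuous coordinate functionals identify its sum. -/
lemma hasSum_single (u : Ell τ) : HasSum (fun j => u.seq j • (single j : Ell τ)) u := by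
  have hs : Summable fun j => u.seq j • (single j : Ell τ) := by
    refine Summable.of_norm ?_
    simp_rw [norm_smul_single]
    exact u.hasSum_norm.summable
  convert hs.hasSum
  ext n
  have h := (coord n).hasSum hs.hasSum
  have he : (fun j => coord n (u.seq j • (single j : Ell τ))) =
      fun j => if j = n then u.seq n else 0 := by
    funext j
    rw [coord_apply, seq_smul, Pi.smul_apply, seq_single, smul_eq_mul]
    by_cases hj : j = n
    · simp [hj]
    · simp [hj, Ne.symm hj]
  rw [he] at h
  exact (hasSum_ite_eq n (u.seq n)).unique h

/-- The operator norm on a weighted `ℓ¹` is the supremum of the column norms. -/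
lemma norm_apply_le_of_columns (T : Ell τ →L[ℝ] Ell τ) {q : ℝ}
    (h : ∀ j, ‖T (single j)‖ ≤ q * (alpha j * τ ^ j)) (u : Ell τ) : ‖T u‖ ≤ q * ‖u‖ := by
  have h1 := T.hasSum u.hasSum_single
  have h2 := u.hasSum_norm.mul_left q
  refine h1.norm_le_of_bounded h2 fun j => ?_
  simp only [map_smul, norm_smul, Real.norm_eq_abs]
  calc _ ≤ |u.seq j| * (q * (alpha j * τ ^ j)) := by gcongr; exact h j
    _ = _ := by ring

/-! ### Diagonal operators -/

/-- The multiplication of the entries by a bounded sequence. -/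
def diag (s : ℕ → ℝ) (C : ℝ) (hs : ∀ n, |s n| ≤ C) : Ell τ →L[ℝ] Ell τ := by
  have hle : ∀ (u : Ell τ) n, |s n * u.seq n| * (alpha n * τ ^ n) ≤
      C * (|u.seq n| * (alpha n * τ ^ n)) := fun u n => by
    rw [abs_mul, mul_assoc]
    exact mul_le_mul_of_nonneg_right (hs n)
      (mul_nonneg (abs_nonneg _) (weight_pos n).le)
  exact LinearMap.mkContinuous
    { toFun := fun u => mk (fun n => s n * u.seq n) (by
        refine Summable.of_nonneg_of_le (fun n => ?_) (fun n => ?_)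
          (u.hasSum_norm.summable.mul_left C)
        · rw [mul_right_comm, mul_comm]
          exact mul_nonneg (abs_nonneg _) (weight_pos n).le
        · rw [mul_right_comm, mul_comm]
          exact hle u n)
      map_add' := fun u v => ext (funext fun n => mul_add _ _ _)
      map_smul' := fun c u => ext (funext fun n => mul_left_comm _ _ _) } C
    fun u => hasSum_le (hle u) (hasSum_norm _) (u.hasSum_norm.mul_left C)

section diag

variable {s : ℕ → ℝ} {C : ℝ} (hs : ∀ n, |s n| ≤ C)

@[simp] lemma seq_diag (u : Ell τ) (n : ℕ) : (diag s C hs u).seq n = s n * u.seq n := rfl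

lemma norm_diag_le (u : Ell τ) : ‖diag s C hs u‖ ≤ C * ‖u‖ := by
  refine hasSum_le (fun n => ?_) (diag s C hs u).hasSum_norm (u.hasSum_norm.mul_left C)
  rw [seq_diag, abs_mul, mul_assoc]
  exact mul_le_mul_of_nonneg_right (hs n) (mul_nonneg (abs_nonneg _) (weight_pos n).le)

lemma norm_diag_sub_le {s' : ℕ → ℝ} {C' ε : ℝ} (hs' : ∀ n, |s' n| ≤ C')
    (h : ∀ n, |s n - s' n| ≤ ε) (u : Ell τ) :
    ‖diag s C hs u - diag s' C' hs' u‖ ≤ ε * ‖u‖ := by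
  convert norm_diag_le h u using 2
  ext n
  simp [sub_mul]

/-- A diagonal operator on a sequence supported in `[N, ∞)`. -/
lemma norm_diag_le_of_support {N : ℕ} {c : ℝ} (h : ∀ n, N ≤ n → |s n| ≤ c) {u : Ell τ}
    (hu : ∀ n < N, u.seq n = 0) : ‖diag s C hs u‖ ≤ c * ‖u‖ := by
  refine hasSum_le (fun n => ?_) (diag s C hs u).hasSum_norm (u.hasSum_norm.mul_left c)
  rcases lt_or_ge n N with hn | hn
  · simp [hu n hn]
  · rw [seq_diag, abs_mul, mul_assoc]
    exact mul_le_mul_of_nonneg_right (h n hn) (mul_nonneg (abs_nonneg _) (weight_pos n).le)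

lemma diag_single (j : ℕ) : diag s C hs (single j : Ell τ) = s j • single j := by
  ext n
  simp only [seq_diag, seq_smul, Pi.smul_apply, seq_single, smul_eq_mul]
  split_ifs with h
  · rw [h]
  · simp

end diag

/-! ### Operators that differ from the identity in finitely many columns -/

/-- The operator whose column `j < N` is `D j` away from that of the identity. -/
def perturb (N : ℕ) (D : ℕ → Ell τ) : Ell τ →L[ℝ] Ell τ :=
  ContinuousLinearMap.id ℝ _ + ∑ j ∈ Finset.range N, (coord j).smulRight (D j)

lemma perturb_apply (N : ℕ) (D : ℕ → Ell τ) (u : Ell τ) :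
    perturb N D u = u + ∑ j ∈ Finset.range N, u.seq j • D j := by
  simp [perturb]

lemma perturb_of_support {N : ℕ} {D : ℕ → Ell τ} {u : Ell τ} (hu : ∀ n < N, u.seq n = 0) :
    perturb N D u = u := by
  rw [perturb_apply, Finset.sum_eq_zero, add_zero]
  intro j hj
  rw [hu j (Finset.mem_range.1 hj), zero_smul]

/-- A product is supported in `[N, ∞)` if the distance of the supports of the factors is `N`. -/
lemma seq_mul_single_eq_zero {a : Ell τ} {d N j n : ℕ} (ha : ∀ m, d ≤ m → a.seq m = 0)
    (hj : N + d ≤ j + 1) (hn : n < N) : (a * single j).seq n = 0 := by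
  rw [seq_mul, conv]
  refine (tsum_congr fun k => ?_).trans tsum_zero
  rw [seq_single]
  split_ifs with h
  · rw [ha _ (by omega), zero_mul]
  · rw [mul_zero]

end Ell

end

end Thomas

namespace Thomas

/-! ### Finite sequences with rational entries -/

namespace QList

/-- The entry number `n`. -/
def get (l : List ℚ) (n : ℕ) : ℚ := l.getD n 0

/-- The list of the first `n` values of a function. -/
def tab (n : ℕ) (f : ℕ → ℚ) : List ℚ := (List.range n).map f

/-- Addition of finite sequences. -/
def add (a b : List ℚ) : List ℚ := tab (max a.length b.length) fun n => get a n + get b n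

/-- Subtraction of finite sequences. -/
def sub (a b : List ℚ) : List ℚ := tab (max a.length b.length) fun n => get a n - get b n

/-- Multiplication of a finite sequence with a constant. -/
def smul (c : ℚ) (a : List ℚ) : List ℚ := tab a.length fun n => c * get a n

/-- Entrywise multiplication of a finite sequence with a sequence. -/
def diag (s : ℕ → ℚ) (a : List ℚ) : List ℚ := tab a.length fun n => s n * get a n

/-- Convolution of finite even sequences. -/
def mul (a b : List ℚ) : List ℚ := tab (a.length + b.length) fun n =>
  get a n * get b 0 + ∑ k ∈ Finset.range b.length,
    (get a (n - (k + 1) + (k + 1 - n)) + get a (n + (k + 1))) * get b (k + 1)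

/-- The weighted norm of a finite sequence. -/
def norm (t : ℚ) (a : List ℚ) : ℚ :=
  |get a 0| + 2 * ∑ n ∈ Finset.range a.length, |get a (n + 1)| * t ^ (n + 1)

/-- The sequence with a single entry `1`. -/
def single (j : ℕ) : List ℚ := tab (j + 1) fun n => if n = j then 1 else 0

/-- Convolution with `single j`. -/
def mulSingle (a : List ℚ) (j : ℕ) : List ℚ := tab (a.length + j) fun n =>
  if j = 0 then get a n else get a (n - j + (j - n)) + get a (n + j)

/-- The action of an operator that differs from the identity in finitely many columns. -/
def perturb (N : ℕ) (D : ℕ → List ℚ) (a : List ℚ) : List ℚ :=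
  (List.range N).foldr (fun j s => add s (smul (get a j) (D j))) a

/-- The finite sequence with the entries of a list at the multiples of `d`. -/
def spread (d : ℕ) (a : List ℚ) : List ℚ :=
  tab (d * a.length) fun n => if n % d = 0 then get a (n / d) else 0

lemma get_of_length_le {l : List ℚ} {n : ℕ} (h : l.length ≤ n) : get l n = 0 := by
  simp [get, h]

lemma get_tab (n : ℕ) (f : ℕ → ℚ) (m : ℕ) : get (tab n f) m = if m < n then f m else 0 := by
  unfold get tab
  split_ifs with h
  · simp [h]
  · simp [not_lt.1 h]

/-- The length of each tabulation is chosen so that its formula vanishes beyond it; list operations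
thus become identities between entries valid for every index. -/
lemma get_tab_of_eq_zero {n : ℕ} {f : ℕ → ℚ} (h : ∀ m, n ≤ m → f m = 0) (m : ℕ) :
    get (tab n f) m = f m := by
  rw [get_tab]
  split_ifs with hm
  · rfl
  · exact (h m (not_lt.1 hm)).symm

lemma get_add (a b : List ℚ) (n : ℕ) : get (add a b) n = get a n + get b n :=
  get_tab_of_eq_zero (fun m hm => by
    rw [get_of_length_le (le_of_max_le_left hm), get_of_length_le (le_of_max_le_right hm),
      add_zero]) n

lemma get_sub (a b : List ℚ) (n : ℕ) : get (sub a b) n = get a n - get b n :=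
  get_tab_of_eq_zero (fun m hm => by
    rw [get_of_length_le (le_of_max_le_left hm), get_of_length_le (le_of_max_le_right hm),
      sub_zero]) n

lemma get_smul (c : ℚ) (a : List ℚ) (n : ℕ) : get (smul c a) n = c * get a n :=
  get_tab_of_eq_zero (fun m hm => by rw [get_of_length_le hm, mul_zero]) n

lemma get_diag (s : ℕ → ℚ) (a : List ℚ) (n : ℕ) : get (diag s a) n = s n * get a n :=
  get_tab_of_eq_zero (fun m hm => by rw [get_of_length_le hm, mul_zero]) n

lemma get_single (j n : ℕ) : get (single j) n = if n = j then 1 else 0 :=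
  get_tab_of_eq_zero (fun m hm => by rw [if_neg (by omega)]) n

/-- The truncated differences add up to |n − (k + 1)|: this is the sum over ℤ with k and −k paired.
-/
lemma get_mul (a b : List ℚ) (n : ℕ) : get (mul a b) n =
    get a n * get b 0 + ∑ k ∈ Finset.range b.length,
      (get a (n - (k + 1) + (k + 1 - n)) + get a (n + (k + 1))) * get b (k + 1) := by
  refine get_tab_of_eq_zero (fun m hm => ?_) n
  rw [get_of_length_le (by omega), zero_mul, zero_add]
  refine Finset.sum_eq_zero fun k hk => ?_
  have := Finset.mem_range.1 hk
  by_cases h : k + 1 = b.length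
  · rw [get_of_length_le h.ge, mul_zero]
  · rw [get_of_length_le (by omega), get_of_length_le (by omega), add_zero, zero_mul]

/-- `mulSingle` replaces the convolution sum by at most two lookups, which keeps the evaluation of
`Data.column` cheap. -/
lemma get_mulSingle (a : List ℚ) (j n : ℕ) :
    get (mulSingle a j) n = get (mul a (single j)) n := by
  rw [mulSingle, get_tab_of_eq_zero, get_mul]
  · rw [show (single j).length = j + 1 by simp [single, tab], get_single]
    simp only [get_single]
    rcases j with _ | i
    · simp
    · rw [Finset.sum_eq_single i]
      · simp
      · intro k _ hk
        rw [if_neg (by omega), mul_zero]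
      · simp
  · intro m hm
    rw [get_of_length_le (by omega), get_of_length_le (by omega), get_of_length_le (by omega)]
    simp

lemma foldr_add_smul (s : List ℕ) (c : ℕ → ℚ) (D : ℕ → List ℚ) (a : List ℚ) (n : ℕ) :
    get (s.foldr (fun j s => add s (smul (c j) (D j))) a) n =
      get a n + (s.map fun j => c j * get (D j) n).sum := by
  induction s with
  | nil => simp
  | cons x s ih => rw [List.foldr_cons, get_add, ih, get_smul, List.map_cons, List.sum_cons]; ring

lemma get_perturb (N : ℕ) (D : ℕ → List ℚ) (a : List ℚ) (n : ℕ) :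
    get (perturb N D a) n = get a n + ∑ j ∈ Finset.range N, get a j * get (D j) n :=
  foldr_add_smul _ _ _ _ _

lemma get_spread {d : ℕ} (hd : 0 < d) (a : List ℚ) (n : ℕ) :
    get (spread d a) n = if n % d = 0 then get a (n / d) else 0 :=
  get_tab_of_eq_zero (fun m hm => by
    rw [get_of_length_le ((Nat.le_div_iff_mul_le hd).2 (by rwa [mul_comm])), ite_self]) n

end QList

/-! ### Rational lists as elements of `Ell τ`. -/

noncomputable section

namespace Ell

variable {τ : ℝ} [hτ : Fact (1 ≤ τ)]

lemma hasSum_mul_nat {g : ℕ → ℝ} {d : ℕ} (hd : 0 < d) (hg : ∀ n, n % d ≠ 0 → g n = 0) {x : ℝ} :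
    HasSum (fun i => g (d * i)) x ↔ HasSum g x := by
  refine Function.Injective.hasSum_iff (g := fun i => d * i)
    (fun a b h => Nat.eq_of_mul_eq_mul_left hd h) fun n hn => hg n fun h => hn ?_
  exact ⟨n / d, Nat.mul_div_cancel' (Nat.dvd_of_mod_eq_zero h)⟩

/-- The sequence with entry `σ ^ n * l[n / d]` at the multiples `n` of `d`. -/
def dilSeq (d : ℕ) (σ : ℝ) (l : List ℚ) : Coeffs := fun n =>
  if n % d = 0 then σ ^ n * (QList.get l (n / d) : ℚ) else 0

lemma dilSeq_mul {d : ℕ} (hd : 0 < d) (σ : ℝ) (l : List ℚ) (i : ℕ) :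
    dilSeq d σ l (d * i) = σ ^ (d * i) * (QList.get l i : ℚ) := by
  simp [dilSeq, hd]

omit hτ in
lemma memEll_dilSeq {d : ℕ} (hd : 0 < d) (σ : ℝ) (l : List ℚ) : MemEll τ (dilSeq d σ l) := by
  refine summable_of_ne_finset_zero (s := Finset.range (d * l.length)) fun n hn => ?_
  have : l.length ≤ n / d := by
    rw [Nat.le_div_iff_mul_le hd, mul_comm]
    simpa using hn
  simp [dilSeq, QList.get_of_length_le this]

/-- `dilSeq` as an element of `ℓ¹_τ(ℕ₀)`. -/
def ofList (d : ℕ) [hd : NeZero d] (σ : ℝ) (l : List ℚ) : Ell τ :=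
  mk (dilSeq d σ l) (memEll_dilSeq (Nat.pos_of_ne_zero hd.out) σ l)

variable {d : ℕ} [hd : NeZero d] {σ : ℝ}

omit hτ in
lemma seq_ofList (l : List ℚ) (n : ℕ) : (ofList d σ l : Ell τ).seq n =
    if n % d = 0 then σ ^ n * (QList.get l (n / d) : ℚ) else 0 := rfl

lemma ofList_add (a b : List ℚ) :
    (ofList d σ (QList.add a b) : Ell τ) = ofList d σ a + ofList d σ b := by
  ext n
  simp only [seq_add, Pi.add_apply, seq_ofList, QList.get_add]
  split_ifs
  · push_cast; ring
  · simp

lemma ofList_sub (a b : List ℚ) :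
    (ofList d σ (QList.sub a b) : Ell τ) = ofList d σ a - ofList d σ b := by
  ext n
  simp only [seq_sub, Pi.sub_apply, seq_ofList, QList.get_sub]
  split_ifs
  · push_cast; ring
  · simp

lemma ofList_smul (c : ℚ) (a : List ℚ) :
    (ofList d σ (QList.smul c a) : Ell τ) = (c : ℝ) • ofList d σ a := by
  ext n
  simp only [seq_smul, Pi.smul_apply, seq_ofList, QList.get_smul, smul_eq_mul]
  split_ifs
  · push_cast; ring
  · simp

omit hτ in
lemma ofList_one : (ofList d σ [1] : Ell τ) = 1 := by
  have hd' := Nat.pos_of_ne_zero hd.out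
  ext n
  rw [seq_ofList, seq_one, e0]
  by_cases h : n = 0
  · subst h; simp [QList.get]
  · rw [if_neg h]
    split_ifs with h1
    · have : n / d ≠ 0 := fun h0 => h (by
        have := Nat.mod_add_div n d
        simpa [h0, h1] using this.symm)
      rw [QList.get_of_length_le (by simpa using Nat.one_le_iff_ne_zero.2 this)]
      simp
    · rfl

lemma diag_ofList {s : ℕ → ℝ} {C : ℝ} (hs : ∀ n, |s n| ≤ C) {r : ℕ → ℚ}
    (h : ∀ i, s (d * i) = r i) (a : List ℚ) :
    diag s C hs (ofList d σ a : Ell τ) = ofList d σ (QList.diag r a) := by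
  ext n
  simp only [seq_diag, seq_ofList, QList.get_diag]
  split_ifs with h1
  · push_cast
    rw [← h, Nat.mul_div_cancel' (Nat.dvd_of_mod_eq_zero h1)]
    ring
  · simp

omit hτ in
lemma ofList_spread (a : List ℚ) :
    (ofList 1 σ (QList.spread d a) : Ell τ) = ofList d σ a := by
  ext n
  simp only [seq_ofList, QList.get_spread (Nat.pos_of_ne_zero hd.out), Nat.mod_one, Nat.div_one,
    if_true]
  split_ifs <;> simp

omit hd in
lemma pow_congr_parity (hσ : σ * σ = 1) {a b : ℕ} (h : a % 2 = b % 2) : σ ^ a = σ ^ b := by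
  rw [← Nat.mod_add_div a 2, ← Nat.mod_add_div b 2, h, pow_add, pow_add, pow_mul, pow_mul, sq, hσ,
    one_pow, one_pow]

lemma single_eq_ofList (hσ : σ * σ = 1) (j : ℕ) :
    (single j : Ell τ) = σ ^ j • ofList 1 σ (QList.single j) := by
  ext n
  simp only [seq_smul, Pi.smul_apply, seq_single, seq_ofList, QList.get_single, Nat.mod_one,
    Nat.div_one, if_true, smul_eq_mul]
  split_ifs with h
  · rw [h, Rat.cast_one, mul_one, ← mul_pow, hσ, one_pow]
  · simp

/-- With columns scaled by σʲ, the operator is the conjugate by diag(σⁿ) of the one for σ = 1; the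
two signs cancel because σ² = 1. -/
lemma perturb_ofList (hσ : σ * σ = 1) (N : ℕ) (D : ℕ → List ℚ) (a : List ℚ) :
    perturb N (fun j => σ ^ j • (ofList 1 σ (D j) : Ell τ)) (ofList 1 σ a) =
      ofList 1 σ (QList.perturb N D a) := by
  ext n
  simp only [perturb_apply, seq_add, Pi.add_apply, seq_sum, seq_smul, Pi.smul_apply, seq_ofList,
    QList.get_perturb, Nat.mod_one, Nat.div_one, if_true, smul_eq_mul]
  push_cast
  rw [mul_add, Finset.mul_sum]
  congr 1
  refine Finset.sum_congr rfl fun j _ => ?_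
  have : σ ^ j * σ ^ j = 1 := by rw [← mul_pow, hσ, one_pow]
  linear_combination (σ ^ n * (QList.get a j : ℝ) * (QList.get (D j) n : ℝ)) * this

/-- Only multiples of d contribute, and |n − k| + |k| has the parity of n, so the factor σⁿ comes
out of the sum. -/
lemma ofList_mul (hσ : σ * σ = 1) (a b : List ℚ) :
    (ofList d σ (QList.mul a b) : Ell τ) = ofList d σ a * ofList d σ b := by
  have hd' := Nat.pos_of_ne_zero hd.out
  ext n
  rw [seq_mul]
  symm
  set F : ℤ → ℝ := fun k =>
    (ofList d σ a : Ell τ).seq (n - k : ℤ).natAbs * (ofList d σ b : Ell τ).seq k.natAbs with hF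
  change ∑' k : ℤ, F k = _
  have hzero : ∀ k : ℤ, k.natAbs % d ≠ 0 → F k = 0 := fun k hk => by
    simp only [hF, seq_ofList, if_neg hk, mul_zero]
  by_cases hn : n % d = 0
  · obtain ⟨m, rfl⟩ : ∃ m, n = d * m := ⟨n / d, (Nat.mul_div_cancel' (Nat.dvd_of_mod_eq_zero hn)).symm⟩
    have hF1 : ∀ i : ℕ, F (d * i : ℕ) = σ ^ (d * m) *
        ((QList.get a (m - i + (i - m)) : ℝ) * (QList.get b i : ℝ)) := fun i => by
      have h1 : (((d * m : ℕ) : ℤ) - ((d * i : ℕ) : ℤ)).natAbs = d * (m - i + (i - m)) := by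
        rcases le_total i m with h | h
        · rw [Nat.sub_eq_zero_of_le h, add_zero, Nat.mul_sub]
          have := Nat.mul_le_mul_left d h
          omega
        · rw [Nat.sub_eq_zero_of_le h, zero_add, Nat.mul_sub]
          have := Nat.mul_le_mul_left d h
          omega
      simp only [hF, h1, Int.natAbs_natCast]
      change dilSeq d σ a _ * dilSeq d σ b _ = _
      rw [dilSeq_mul hd', dilSeq_mul hd', mul_mul_mul_comm, ← pow_add]
      congr 1
      refine pow_congr_parity hσ ?_
      rw [← mul_add, Nat.mul_mod, Nat.mul_mod d m]
      congr 2
      omega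
    have hF2 : ∀ i : ℕ, F (-(d * i : ℕ)) = σ ^ (d * m) *
        ((QList.get a (m + i) : ℝ) * (QList.get b i : ℝ)) := fun i => by
      have h1 : (((d * m : ℕ) : ℤ) - -((d * i : ℕ) : ℤ)).natAbs = d * (m + i) := by
        rw [mul_add]; omega
      simp only [hF, h1, Int.natAbs_neg, Int.natAbs_natCast]
      change dilSeq d σ a _ * dilSeq d σ b _ = _
      rw [dilSeq_mul hd', dilSeq_mul hd', mul_mul_mul_comm, ← pow_add]
      congr 1
      refine pow_congr_parity hσ ?_
      rw [← mul_add, Nat.mul_mod, Nat.mul_mod d m]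
      congr 2
      omega
    have hs1 : HasSum (fun k : ℕ => F k) (∑ i ∈ Finset.range (b.length + 1), F (d * i : ℕ)) := by
      rw [← hasSum_mul_nat hd' fun k hk => hzero k (by simpa using hk)]
      refine hasSum_sum_of_ne_finset_zero fun i hi => ?_
      rw [hF1, QList.get_of_length_le (l := b) (by simp at hi; omega)]
      simp
    have hs2 : HasSum (fun k : ℕ => F (-k))
        (∑ i ∈ Finset.range (b.length + 1), F (-(d * i : ℕ))) := by
      rw [← hasSum_mul_nat hd' fun k hk => hzero (-k) (by simpa using hk)]
      refine hasSum_sum_of_ne_finset_zero fun i hi => ?_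
      rw [hF2, QList.get_of_length_le (l := b) (by simp at hi; omega)]
      simp
    -- Both half-line sums contain the term k = 0, which is subtracted once.
    rw [(HasSum.of_nat_of_neg hs1 hs2).tsum_eq]
    change _ = dilSeq d σ _ _
    rw [dilSeq_mul hd', QList.get_mul, Finset.sum_range_succ', Finset.sum_range_succ']
    have h0 : F 0 = F (d * 0 : ℕ) := by simp
    have h0' : F (-(d * 0 : ℕ)) = F (d * 0 : ℕ) := by simp
    rw [h0', h0, hF1]
    simp_rw [hF1, hF2]
    push_cast
    simp only [Nat.sub_zero, Nat.zero_sub, add_zero, add_mul, Finset.sum_add_distrib, mul_add,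
      Finset.mul_sum]
    ring
  · rw [seq_ofList, if_neg hn]
    refine (tsum_congr fun k => ?_).trans tsum_zero
    by_cases hk : k.natAbs % d = 0
    · have : (n - k : ℤ).natAbs % d ≠ 0 := fun h => hn (by
        rw [← Nat.dvd_iff_mod_eq_zero, ← Int.natCast_dvd_natCast] at *
        rw [Int.dvd_natAbs] at h hk
        simpa using dvd_add h hk)
      simp only [hF, seq_ofList, if_neg this, zero_mul]
    · exact hzero k hk

omit hτ in
lemma ofList_mulSingle (a : List ℚ) (j : ℕ) :
    (ofList d σ (QList.mulSingle a j) : Ell τ) = ofList d σ (QList.mul a (QList.single j)) := by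
  ext n
  simp only [seq_ofList, QList.get_mulSingle]

omit hτ in
-- As |σ| = 1 the norm does not see σ, and spreading by d replaces the weight τ by τᵈ.
lemma norm_ofList (hσ : σ * σ = 1) {t : ℚ} (ht : (t : ℝ) = τ ^ d) (a : List ℚ) :
    ‖(ofList d σ a : Ell τ)‖ = (QList.norm t a : ℝ) := by
  have hd' := Nat.pos_of_ne_zero hd.out
  have hσ' : |σ| = 1 := by
    have : |σ| * |σ| = 1 := by rw [← abs_mul, hσ, abs_one]
    nlinarith [abs_nonneg σ]
  have hw : ∀ i, |(ofList d σ a : Ell τ).seq (d * i)| * (alpha (d * i) * τ ^ (d * i)) =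
      alpha i * (|QList.get a i| * t ^ i : ℚ) := fun i => by
    change |dilSeq d σ a (d * i)| * _ = _
    rw [dilSeq_mul hd', abs_mul, abs_pow, hσ', one_pow, one_mul, pow_mul, ← ht]
    have : alpha (d * i) = alpha i := by simp [alpha, hd'.ne']
    rw [this]
    push_cast
    ring
  have h := (ofList d σ a : Ell τ).hasSum_norm
  rw [← hasSum_mul_nat hd' fun n hn => by rw [seq_ofList, if_neg hn, abs_zero, zero_mul]] at h
  simp_rw [hw] at h
  refine h.unique ?_
  have h2 := hasSum_sum_of_ne_finset_zero (L := .unconditional ℕ)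
    (f := fun i => alpha i * ((|QList.get a i| * t ^ i : ℚ) : ℝ))
    (s := Finset.range (a.length + 1)) fun i hi => by
      rw [QList.get_of_length_le (by simp at hi; omega)]; simp
  convert h2 using 1
  rw [Finset.sum_range_succ', QList.norm]
  simp only [alpha, Nat.add_eq_zero_iff, one_ne_zero, and_false, if_false, if_true, pow_zero,
    mul_one, one_mul, ← Finset.mul_sum]
  push_cast
  ring

end Ell
end

end Thomas

namespace Thomas

noncomputable section

/-! ### Inverses in Banach algebras -/

section inverse

variable {E : Type*} [NormedCommRing E] [CompleteSpace E]

/-- By the Neumann series k x is a unit, and in a commutative ring so is its factor x. -/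
lemma isUnit_of_norm_one_sub_mul_lt {k x : E} (h : ‖1 - k * x‖ < 1) : IsUnit x := by
  have h1 := (Units.oneSub (1 - k * x) h).isUnit
  rw [Units.val_oneSub, sub_sub_cancel] at h1
  exact isUnit_of_mul_isUnit_right h1

lemma norm_inverse_le {k x : E} {θ : ℝ} (h : ‖1 - k * x‖ ≤ θ) (hθ : θ < 1) :
    ‖Ring.inverse x‖ ≤ ‖k‖ / (1 - θ) := by
  have hx : x * Ring.inverse x = 1 :=
    Ring.mul_inverse_cancel x (isUnit_of_norm_one_sub_mul_lt (h.trans_lt hθ))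
  have h1 : Ring.inverse x = k + (1 - k * x) * Ring.inverse x := by
    linear_combination k * hx
  have h2 : ‖Ring.inverse x‖ ≤ ‖k‖ + θ * ‖Ring.inverse x‖ := by
    conv_lhs => rw [h1]
    exact norm_add_le_of_le le_rfl (norm_mul_le_of_le h le_rfl)
  rw [le_div_iff₀ (by linarith)]
  linarith

end inverse

/-! ### The fixed point problem -/

/-- An approximate solution `u` of `x = P (21 - (m x² - 8 x (S x + κ)) / (1 + x + x²))` together
with an approximate inverse `A` of the linearization. -/
structure ApproxSolution (E : Type*) [NormedCommRing E] [NormedAlgebra ℝ E] where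
  /-- The coefficient of `x²` in the numerator. -/
  m : E
  /-- The constant part of the second component. -/
  κ : E
  /-- The inverse of the linear part of the first equation. -/
  P : E →L[ℝ] E
  /-- The linear part of the second component. -/
  S : E →L[ℝ] E
  /-- The approximate inverse of the linearization. -/
  A : E →L[ℝ] E
  /-- The first component of the approximate solution. -/
  u : E
  /-- The second component of the approximate solution. -/
  v : E
  /-- The approximate value of the quotient. -/
  w : E
  /-- The approximate derivative of the quotient in the first component. -/
  a : E
  /-- The approximate derivative of the quotient in the second component. -/
  b : E
  /-- The approximate inverse of the denominator. -/
  k : E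
  norm_m : ‖m‖ ≤ 1.4112
  norm_P : ∀ x, ‖P x‖ ≤ 1 * ‖x‖
  norm_S : ∀ x, ‖S x‖ ≤ 3.4 * ‖x‖
  norm_A : ∀ x, ‖A x‖ ≤ 130 * ‖x‖
  norm_u : ‖u‖ ≤ 6.4
  norm_v : ‖v‖ ≤ 12.4
  norm_w : ‖w‖ ≤ 16.1
  norm_a : ‖a‖ ≤ 2.2
  norm_b : ‖b‖ ≤ 1.3
  norm_k : ‖k‖ ≤ 0.0245
  norm_one_sub : ‖1 - k * (1 + u + u * u)‖ ≤ 0.15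
  norm_residual : ‖(1 + u + u * u) * w - (m * (u * u) - 8 * (u * v))‖ ≤ 5e-12
  norm_residual_fst : ‖u - P (21 - w)‖ ≤ 1e-13
  norm_residual_snd : ‖S u + κ - v‖ ≤ 1e-13
  norm_residual_a : ‖2 * m * u - 8 * v - w * (1 + 2 * u) - (1 + u + u * u) * a‖ ≤ 0.004
  norm_residual_b : ‖-8 * u - (1 + u + u * u) * b‖ ≤ 0.001
  norm_linear : ∀ h, ‖h - A (h + P (a * h + b * S h))‖ ≤ 0.4 * ‖h‖
  injective : ∀ x, A x = 0 → x = 0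

namespace ApproxSolution

variable {E : Type*} [NormedCommRing E] [NormedAlgebra ℝ E]
  (X : ApproxSolution E)

/-- The second component as a function of the first one. -/
def snd (x : E) : E := X.S x + X.κ

/-- The denominator. -/
def den (x : E) : E := 1 + x + x * x

/-- The numerator. -/
def num (x : E) : E := X.m * (x * x) - 8 * (x * X.snd x)

/-- The quotient. -/
def quot (x : E) : E := X.num x * Ring.inverse (den x)

/-- The right-hand side of the fixed point equation. -/
def rhs (x : E) : E := X.P (21 - X.quot x)

/-- The quasi-Newton map. -/
def newton (x : E) : E := x - X.A (x - X.rhs x)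

lemma newton_eq_self_iff (x : E) : X.newton x = x ↔ x = X.rhs x := by
  rw [newton, sub_eq_self]
  refine ⟨fun h => sub_eq_zero.1 (X.injective _ h), fun h => ?_⟩
  rw [← h, sub_self, map_zero]

omit [NormedAlgebra ℝ E] in
lemma norm_natCast_mul_le (n : ℕ) (x : E) : ‖(n : E) * x‖ ≤ n * ‖x‖ := by
  rw [← nsmul_eq_mul]
  exact norm_nsmul_le

omit [NormedAlgebra ℝ E] in
lemma norm_eight_mul_le {x : E} {c : ℝ} (h : ‖x‖ ≤ c) : ‖8 * x‖ ≤ 8 * c := by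
  have := norm_natCast_mul_le 8 x
  push_cast at this
  linarith

/-! ### Estimates on the ball of radius 1e-8 about the approximate solution. -/

section ball

variable {X} {x y : E} (hx : ‖x - X.u‖ ≤ 1e-8) (hy : ‖y - X.u‖ ≤ 1e-8)
include hx

lemma norm_le : ‖x‖ ≤ 6.41 := by
  have := norm_le_norm_add_norm_sub' x X.u
  linarith [X.norm_u]

lemma norm_snd_sub_le : ‖X.snd x - X.v‖ ≤ 3.5e-8 := by
  have h : X.snd x - X.v = X.S (x - X.u) + (X.S X.u + X.κ - X.v) := by
    simp only [snd, map_sub]; ring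
  rw [h]
  refine (norm_add_le_of_le ((X.norm_S _).trans (mul_le_mul_of_nonneg_left hx (by norm_num)))
    X.norm_residual_snd).trans (by norm_num)

lemma norm_snd_le : ‖X.snd x‖ ≤ 12.5 := by
  have := norm_le_norm_add_norm_sub' (X.snd x) X.v
  linarith [X.norm_v, norm_snd_sub_le hx]

variable [NormOneClass E]

lemma norm_den_sub_le : ‖den x - den X.u‖ ≤ 1.4e-7 := by
  have h : den x - den X.u = (x - X.u) * (1 + x + X.u) := by simp only [den]; ring
  rw [h]
  refine (norm_mul_le_of_le hx (norm_add_le_of_le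
    (norm_add_le_of_le norm_one.le (norm_le hx)) X.norm_u)).trans (by norm_num)

lemma norm_one_sub_le : ‖1 - X.k * den x‖ ≤ 0.16 := by
  have h : 1 - X.k * den x = (1 - X.k * den X.u) - X.k * (den x - den X.u) := by ring
  rw [h]
  exact (norm_sub_le_of_le X.norm_one_sub
    (norm_mul_le_of_le X.norm_k (norm_den_sub_le hx))).trans (by norm_num)

lemma isUnit_den [CompleteSpace E] : IsUnit (den x) :=
  isUnit_of_norm_one_sub_mul_lt ((norm_one_sub_le hx).trans_lt (by norm_num))

lemma norm_inverse_den_le [CompleteSpace E] : ‖Ring.inverse (den x)‖ ≤ 0.03 := by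
  refine (norm_inverse_le (norm_one_sub_le hx) (by norm_num)).trans ?_
  rw [div_le_iff₀ (by norm_num)]
  exact X.norm_k.trans (by norm_num)

lemma norm_num_sub_le : ‖den x * X.w - X.num x‖ ≤ 6e-6 := by
  have h : den x * X.w - X.num x =
      ((1 + X.u + X.u * X.u) * X.w - (X.m * (X.u * X.u) - 8 * (X.u * X.v)))
      + (den x - den X.u) * X.w
      - (X.m * ((x - X.u) * (x + X.u))
        - 8 * ((x - X.u) * X.snd x + X.u * (X.snd x - X.v))) := by
    simp only [den, num]; ring
  rw [h]
  refine (norm_sub_le_of_le (norm_add_le_of_le X.norm_residual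
    (norm_mul_le_of_le (norm_den_sub_le hx) X.norm_w))
    (norm_sub_le_of_le (norm_mul_le_of_le X.norm_m
      (norm_mul_le_of_le hx (norm_add_le_of_le (norm_le hx) X.norm_u)))
      (norm_eight_mul_le (norm_add_le_of_le (norm_mul_le_of_le hx (norm_snd_le hx))
        (norm_mul_le_of_le X.norm_u (norm_snd_sub_le hx)))))).trans (by norm_num)

variable [CompleteSpace E]

lemma den_mul_inverse : den x * Ring.inverse (den x) = 1 :=
  Ring.mul_inverse_cancel _ (isUnit_den hx)

lemma quot_sub_w : X.quot x - X.w = -(Ring.inverse (den x) * (den x * X.w - X.num x)) := by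
  rw [quot]
  linear_combination X.w * den_mul_inverse hx

lemma norm_quot_sub_le : ‖X.quot x - X.w‖ ≤ 2e-7 := by
  rw [quot_sub_w hx, norm_neg]
  exact (norm_mul_le_of_le (norm_inverse_den_le hx) (norm_num_sub_le hx)).trans (by norm_num)

include hy

/-- This is (num x − num y − q(y)(den x − den y)) / den x. The factors in front of x − y and S(x −
y) are divided differences, close to a and b when x and y are near u. -/
lemma quot_sub_quot : X.quot x - X.quot y = Ring.inverse (den x) *
      ((X.m * (x + y) - 8 * X.snd x - X.quot y * (1 + x + y)) * (x - y)
        + -8 * y * X.S (x - y)) := by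
  have h1 : X.S (x - y) = X.snd x - X.snd y := by simp only [snd, map_sub]; ring
  have h2 : X.quot y * den y = X.num y := by
    rw [quot]
    linear_combination X.num y * den_mul_inverse hy
  have h3 : X.m * (x + y) * (x - y) - 8 * X.snd x * (x - y) + -8 * y * (X.snd x - X.snd y)
      = X.num x - X.num y := by simp only [num]; ring
  have h4 : (1 + x + y) * (x - y) = den x - den y := by simp only [den]; ring
  rw [h1]
  have h5 : X.quot x = X.num x * Ring.inverse (den x) := rfl
  linear_combination h5 - Ring.inverse (den x) * h3 + X.quot y * Ring.inverse (den x) * h4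
    + X.quot y * den_mul_inverse hx - Ring.inverse (den x) * h2

/-- The residual 0.004 of a, times the bound 0.03 for the inverse denominator, dominates; the terms
from x, y ≠ u are far smaller. -/
lemma norm_coeff_a_le : ‖Ring.inverse (den x) *
    (X.m * (x + y) - 8 * X.snd x - X.quot y * (1 + x + y)) - X.a‖ ≤ 2e-4 := by
  have h : Ring.inverse (den x) * (X.m * (x + y) - 8 * X.snd x - X.quot y * (1 + x + y)) - X.a =
      Ring.inverse (den x) *
      ((2 * X.m * X.u - 8 * X.v - X.w * (1 + 2 * X.u) - (1 + X.u + X.u * X.u) * X.a)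
        + (X.m * ((x - X.u) + (y - X.u)) - 8 * (X.snd x - X.v)
        - ((X.quot y - X.w) * (1 + x + y) + X.w * ((x - X.u) + (y - X.u)))
        - (den x - den X.u) * X.a)) := by
    have h1 : den X.u = 1 + X.u + X.u * X.u := rfl
    rw [h1]
    linear_combination X.a * den_mul_inverse hx
  rw [h]
  refine (norm_mul_le_of_le (norm_inverse_den_le hx) (norm_add_le_of_le X.norm_residual_a
    (norm_sub_le_of_le (norm_sub_le_of_le (norm_sub_le_of_le
      (norm_mul_le_of_le X.norm_m (norm_add_le_of_le hx hy))
      (norm_eight_mul_le (norm_snd_sub_le hx)))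
      (norm_add_le_of_le (norm_mul_le_of_le (norm_quot_sub_le hy)
        (norm_add_le_of_le (norm_add_le_of_le norm_one.le (norm_le hx)) (norm_le hy)))
        (norm_mul_le_of_le X.norm_w (norm_add_le_of_le hx hy))))
      (norm_mul_le_of_le (norm_den_sub_le hx) X.norm_a)))).trans (by norm_num)

lemma norm_coeff_b_le : ‖Ring.inverse (den x) * (-8 * y) - X.b‖ ≤ 1e-4 := by
  have h : Ring.inverse (den x) * (-8 * y) - X.b = Ring.inverse (den x) *
      ((-8 * X.u - (1 + X.u + X.u * X.u) * X.b)
        - (8 * (y - X.u) + (den x - den X.u) * X.b)) := by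
    have h1 : den X.u = 1 + X.u + X.u * X.u := rfl
    rw [h1]
    linear_combination X.b * den_mul_inverse hx
  rw [h]
  refine (norm_mul_le_of_le (norm_inverse_den_le hx) (norm_sub_le_of_le X.norm_residual_b
    (norm_add_le_of_le (norm_eight_mul_le hy)
      (norm_mul_le_of_le (norm_den_sub_le hx) X.norm_b)))).trans (by norm_num)

/-- The fixed linearization contributes 0.4; replacing a, b by the true divided differences adds at
most 130 · (2e-4 + 3.4 · 1e-4) < 0.1. -/
lemma norm_newton_sub_le : ‖X.newton x - X.newton y‖ ≤ 0.5 * ‖x - y‖ := by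
  set h := x - y with hh
  set a' := Ring.inverse (den x) * (X.m * (x + y) - 8 * X.snd x - X.quot y * (1 + x + y)) - X.a
    with ha
  set b' := Ring.inverse (den x) * (-8 * y) - X.b with hb
  have h1 : X.newton x - X.newton y = (h - X.A (h + X.P (X.a * h + X.b * X.S h)))
      - X.A (X.P (a' * h + b' * X.S h)) := by
    have h2 : X.rhs x - X.rhs y = -(X.P (X.a * h + X.b * X.S h) + X.P (a' * h + b' * X.S h)) := by
      rw [rhs, rhs, ← map_sub, ← map_add, ← map_neg]
      congr 1
      have := quot_sub_quot hx hy
      rw [ha, hb]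
      linear_combination -this
    have h3 : X.newton x - X.newton y = h - X.A (h - (X.rhs x - X.rhs y)) := by
      simp only [newton, map_sub, hh]; abel
    rw [h3, h2]
    simp only [map_add, map_sub, map_neg]; abel
  rw [h1]
  have h4 : ‖X.P (a' * h + b' * X.S h)‖ ≤ 1 * (2e-4 * ‖h‖ + 1e-4 * (3.4 * ‖h‖)) :=
    (X.norm_P _).trans (mul_le_mul_of_nonneg_left (norm_add_le_of_le
      (norm_mul_le_of_le (norm_coeff_a_le hx hy) le_rfl)
      (norm_mul_le_of_le (norm_coeff_b_le hx hy) (X.norm_S h))) zero_le_one)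
  refine (norm_sub_le_of_le (X.norm_linear h) ((X.norm_A _).trans
    (mul_le_mul_of_nonneg_left h4 (by norm_num)))).trans ?_
  linarith [norm_nonneg h]

end ball

/-! ### Existence and uniqueness of the fixed point. -/

variable [NormOneClass E] [CompleteSpace E]

lemma norm_newton_u_sub_le : ‖X.newton X.u - X.u‖ ≤ 1e-10 := by
  have h0 : ‖X.u - X.u‖ ≤ 1e-8 := by rw [sub_self, norm_zero]; norm_num
  have h1 : ‖den X.u * X.w - X.num X.u‖ ≤ 1.2e-11 := by
    have h : den X.u * X.w - X.num X.u =
      ((1 + X.u + X.u * X.u) * X.w - (X.m * (X.u * X.u) - 8 * (X.u * X.v)))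
        + 8 * (X.u * (X.S X.u + X.κ - X.v)) := by
      simp only [den, num, snd]; ring
    rw [h]
    exact (norm_add_le_of_le X.norm_residual (norm_eight_mul_le
      (norm_mul_le_of_le X.norm_u X.norm_residual_snd))).trans (by norm_num)
  have h2 : X.newton X.u - X.u = -(X.A ((X.u - X.P (21 - X.w)) + X.P (X.quot X.u - X.w))) := by
    simp only [newton, rhs, map_sub, map_add]; abel
  rw [h2, norm_neg, quot_sub_w h0]
  have h3 : ‖-(Ring.inverse (den X.u) * (den X.u * X.w - X.num X.u))‖ ≤ 0.03 * 1.2e-11 := by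
    rw [norm_neg]
    exact norm_mul_le_of_le (norm_inverse_den_le h0) h1
  exact ((X.norm_A _).trans (mul_le_mul_of_nonneg_left (norm_add_le_of_le X.norm_residual_fst
    ((X.norm_P _).trans (mul_le_mul_of_nonneg_left h3 zero_le_one))) (by norm_num))).trans
      (by norm_num)

theorem eq_of_eq_rhs {x y : E} (hx : ‖x - X.u‖ ≤ 1e-8) (hy : ‖y - X.u‖ ≤ 1e-8)
    (h1 : x = X.rhs x) (h2 : y = X.rhs y) : x = y := by
  have h := norm_newton_sub_le hx hy
  rw [(X.newton_eq_self_iff x).2 h1, (X.newton_eq_self_iff y).2 h2] at h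
  have h0 : ‖x - y‖ = 0 := by linarith [norm_nonneg (x - y)]
  exact sub_eq_zero.1 (norm_eq_zero.1 h0)

theorem exists_eq_rhs : ∃ x : E, ‖x - X.u‖ ≤ 2e-10 ∧ x = X.rhs x := by
  have hmem : ∀ x ∈ Metric.closedBall X.u 2e-10, ‖x - X.u‖ ≤ 1e-8 := fun x hx => by
    rw [mem_closedBall_iff_norm] at hx
    exact hx.trans (by norm_num)
  -- The radius is twice the defect 1e-10, as a contraction by 1/2 requires.
  have hmaps : Set.MapsTo X.newton (Metric.closedBall X.u 2e-10) (Metric.closedBall X.u 2e-10) := by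
    intro x hx
    have h1 := norm_newton_sub_le (hmem x hx)
      (hmem X.u (Metric.mem_closedBall_self (by norm_num)))
    rw [mem_closedBall_iff_norm] at hx ⊢
    have h2 := norm_add_le (X.newton x - X.newton X.u) (X.newton X.u - X.u)
    rw [sub_add_sub_cancel] at h2
    have := X.norm_newton_u_sub_le
    linarith
  have hc : ContractingWith (1 / 2) (hmaps.restrict X.newton _ _) := by
    refine ⟨by rw [← NNReal.coe_lt_coe]; norm_num, LipschitzWith.of_dist_le_mul fun x y => ?_⟩
    have := norm_newton_sub_le (hmem x x.2) (hmem y y.2)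
    rw [Subtype.dist_eq, Subtype.dist_eq, dist_eq_norm, dist_eq_norm]
    refine this.trans (le_of_eq ?_)
    norm_num
  obtain ⟨x, hx, hfix, -⟩ := hc.exists_fixedPoint' Metric.isClosed_closedBall.isComplete hmaps
    (Metric.mem_closedBall_self (x := X.u) (by norm_num)) (edist_ne_top _ _)
  exact ⟨x, mem_closedBall_iff_norm.1 hx, (X.newton_eq_self_iff x).1 hfix⟩

end ApproxSolution

end

end Thomas

namespace Thomas

namespace Data

/-! ### Numerical data -/

/-- The square of `π` to 16 digits. -/
def piSq : ℚ := 9.8696044010893586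

/-- The factors `1 + ν (π n / d)²`. -/
def lam (n : ℕ) : ℚ := 1 + 0.1764 * (piSq * (n ^ 2 / 25))

/-- The factors `(ν₃ ν - 1) / (ν₃ + (π n / d)²)`. -/
def mu (n : ℕ) : ℚ := -0.950608 / (0.28 + piSq * (n ^ 2 / 25))

/-- Rounding to six digits. -/
def round6 (x : ℚ) : ℚ := ⌊x * 10 ^ 6⌋ / 10 ^ 6

/-- The coefficients of the first component of the center. -/
def u₀ : List ℚ :=
  [5.816734553510635, 0.230392933315547, -0.006831793543855, 0.000220538873028,
    -0.000008112591562, 0.000000324772264, -0.000000013663755, 0.000000000588158,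
    -0.000000000025265, 0.00000000000105]

/-- The coefficients of the first component of the approximate solution. -/
def u : List ℚ :=
  [5.816734553510635, 0.230392933315547, -0.006831793543855, 0.000220538873028,
    -0.000008112591562, 0.000000324772264, -0.000000013663755, 0.000000000588158,
    -0.000000000025265119, 0.000000000001049795, -0.000000000000039887, 0.00000000000000116]

/-- The coefficients of the second component of the approximate solution. -/
def v : List ℚ :=
  [-12.217798605299359, -0.05713803164477, 0.000448126854588, -0.000006499136583,
    0.000000134991074, -0.000000003464745, 0.000000000101325, -0.000000000003206,
    0.000000000000105, -0.000000000000003]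

/-- The constant part of the second component. -/
def kap : ℚ := (21 - 0.28 * 67.46981860371494) / 0.28

/-- The coefficients of the denominator. -/
def den : List ℚ := QList.add (QList.add [1] u) (QList.mul u u)

/-- The coefficients of `Λ u`. -/
def lamU : List ℚ := QList.diag (fun i => lam (3 * i)) u

/-- The coefficients of the quotient. -/
def w : List ℚ := QList.sub (QList.smul 21 [1]) lamU

/-- The coefficients of the derivative of the quotient in the first component. -/
def a : List ℚ := [-1.91235, 0.108369, -0.007963, 0.00055]

/-- The coefficients of the derivative of the quotient in the second component. -/
def b : List ℚ := [-1.146981, 0.036789, -0.002225, 0.000136]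

/-- The columns of the approximate inverse of the linearization, minus the identity. -/
def invTable : List (List ℚ) := [
  [-0.638, 0, 0, -0.4, 0, 0, 0.024, 0, 0, -0.001],
  [0, 0.258, 1.273, 0, -0.173, -0.116, 0, 0.009, 0.006],
  [0, 2.409, -20.76, 0, -0.752, 1.914, 0, 0.039, -0.094],
  [7.857, 0, 0, -118.468, 0, 0, 7.041, 0, 0, -0.34],
  [0, -0.624, -1.413, 0, 4.897, 0.129, 0, -0.239, -0.006],
  [0, -0.555, 4.803, 0, 0.174, 1.473, 0, -0.009, -0.063],
  [-1.072, 0, 0, 16.187, 0, 0, 0.133],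
  [0, 0.068, 0.154, 0, -0.515, -0.014, 0, 0.747, 0.001],
  [0, 0.055, -0.471, 0, -0.017, -0.129, 0, 0.001, 0.524],
  [0.098, 0, 0, -1.485, 0, 0, -0.001, 0, 0, 0.392]]

/-- The columns of the linearization, minus the identity. -/
def linTable : List (List ℚ) := [
  [1.9817, 0, 0, -0.0102, 0, 0, -0.0001],
  [0, -0.2772, 0.0442, 0, 0.0267, -0.0018, 0, -0.0011, 0.0001],
  [0, 0.0837, -1.037, 0, -0.0032, 0.0327, 0, 0.0001, -0.0013],
  [0.1985, 0, 0, -1.0053, 0, 0, 0.0284, 0, 0, -0.0011],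
  [0, 0.0964, -0.006, 0, -0.8263, 0.0002, 0, 0.0234],
  [0, -0.0072, 0.0821, 0, 0.0003, -0.6585, 0, 0, 0.0192],
  [-0.0156, 0, 0, 0.0655, 0, 0, -0.5238, 0, 0, 0.016],
  [0, -0.0073, 0.0004, 0, 0.0504, 0, 0, -0.4208],
  [0, 0.0005, -0.0062, 0, 0, 0.039, 0, 0, -0.3426],
  [0.0011, 0, 0, -0.0049, 0, 0, 0.0306, 0, 0, -0.2829]]

/-- The columns of the approximate inverse of the linearization, minus the identity. -/
def invCol (j : ℕ) : List ℚ := invTable.getD j []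

/-- The columns of the linearization, minus the identity. -/
def linCol (j : ℕ) : List ℚ := linTable.getD j []

/-- The columns of the preconditioned linearization. -/
def column (j : ℕ) : List ℚ :=
  QList.sub (QList.single j) (QList.perturb 10 invCol (QList.add (QList.single j)
    (QList.diag (fun n => round6 (lam n)⁻¹)
      (QList.add (QList.mulSingle (QList.spread 3 a) j)
        (QList.smul (round6 (mu j)) (QList.mulSingle (QList.spread 3 b) j))))))

/-- The weights of the norm. -/
def weight (j : ℕ) : ℚ := (if j = 0 then 1 else 2) * 1.01 ^ j


/-! ### Rational inequalities verified by kernel computation. -/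

lemma norm_u_le : QList.norm (1.01 ^ 3) u ≤ 6.4 := by decide +kernel
lemma norm_v_le : QList.norm (1.01 ^ 3) v ≤ 12.4 := by decide +kernel
lemma norm_w_le : QList.norm (1.01 ^ 3) w ≤ 16.1 := by decide +kernel
lemma norm_a_le : QList.norm (1.01 ^ 3) a ≤ 2.2 := by decide +kernel
lemma norm_b_le : QList.norm (1.01 ^ 3) b ≤ 1.3 := by decide +kernel
lemma norm_lamU_le : QList.norm (1.01 ^ 3) lamU ≤ 20 := by decide +kernel

/-- `u` refines `u₀` only in modes 24 to 33. The factors `lam` exceed 40 there, so the quotient `w`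
is much more sensitive to this tail than the norm is. -/
lemma norm_sub_center_le : QList.norm (1.01 ^ 3) (QList.sub u u₀) ≤ 1e-12 := by decide +kernel

/-- A scalar approximate inverse suffices: the denominator is dominated by its mean, about 1/0.0245.
-/
lemma norm_one_sub_le :
    QList.norm (1.01 ^ 3) (QList.sub [1] (QList.smul 0.0245 den)) ≤ 0.15 := by decide +kernel

lemma norm_residual_le : QList.norm (1.01 ^ 3) (QList.sub (QList.mul den w)
    (QList.sub (QList.smul 1.4112 (QList.mul u u)) (QList.smul 8 (QList.mul u v)))) ≤ 5e-12 := by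
  decide +kernel

lemma norm_residual_snd_le : QList.norm (1.01 ^ 3) (QList.sub (QList.add
    (QList.diag (fun i => mu (3 * i)) u) (QList.smul kap [1])) v) ≤ 5e-14 := by
  decide +kernel

lemma norm_residual_a_le : QList.norm (1.01 ^ 3) (QList.sub (QList.sub (QList.sub
    (QList.smul 2.8224 u) (QList.smul 8 v)) (QList.mul w (QList.add [1] (QList.smul 2 u))))
    (QList.mul den a)) ≤ 0.004 := by
  decide +kernel

lemma norm_residual_b_le :
    QList.norm (1.01 ^ 3) (QList.sub (QList.smul (-8) u) (QList.mul den b)) ≤ 0.001 := by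
  decide +kernel

lemma norm_column_le : ∀ j < 19, QList.norm 1.01 (column j) ≤ 0.35 * weight j := by
  decide +kernel

/-- The size 130 comes from the diagonal entry −118.468 in column 3: the linearization is nearly
singular in that mode. -/
lemma norm_inv_le : ∀ j < 10,
    QList.norm 1.01 (QList.perturb 10 invCol (QList.single j)) ≤ 130 * weight j := by
  decide +kernel

lemma norm_one_sub_lin_mul_inv_le : ∀ j < 10, QList.norm 1.01 (QList.sub (QList.single j)
    (QList.perturb 10 linCol (QList.perturb 10 invCol (QList.single j)))) ≤ 0.5 * weight j := by
  decide +kernel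

end Data

end Thomas

namespace Thomas

noncomputable section

open Ell

/-- The space `ℓ¹_τ(ℕ₀)` for `τ = 1.01`. -/
abbrev Ell101 : Type := Ell 1.01

instance : Fact ((1 : ℝ) ≤ 1.01) := ⟨by norm_num⟩

/-! ### The diagonal operators and their rational approximations -/

/-- The factors `1 + ν (π n / d)²`. -/
def lamR (n : ℕ) : ℝ := 1 + 0.1764 * (Real.pi ^ 2 * (n ^ 2 / 25))

/-- The factors `(ν₃ ν - 1) / (ν₃ + (π n / d)²)`. -/
def muR (n : ℕ) : ℝ := -0.950608 / (0.28 + Real.pi ^ 2 * (n ^ 2 / 25))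

lemma abs_piSq_sub_le : |Real.pi ^ 2 - (Data.piSq : ℝ)| ≤ 1e-15 := by
  have h1 := Real.pi_gt_d20
  have h2 := Real.pi_lt_d20
  rw [Data.piSq, abs_le]
  push_cast
  constructor <;> norm_num at * <;> nlinarith

/-- The difference is γt(π² − q) over the product of the two denominators; one is at least γt and
the other at least β, so the bound is uniform in t. -/
lemma abs_inv_sub_inv_le {β γ t : ℝ} (hβ : 0 < β) (hγ : 0 < γ) (ht : 0 ≤ t) :
    |(β + γ * (Real.pi ^ 2 * t))⁻¹ - (β + γ * (Data.piSq * t))⁻¹| ≤ 1e-15 / β := by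
  have hp : (1 : ℝ) ≤ Data.piSq := by rw [Data.piSq]; norm_num
  have h1 : β ≤ β + γ * (Real.pi ^ 2 * t) := le_add_of_nonneg_right (by positivity)
  have h2 : γ * t ≤ β + γ * (Data.piSq * t) := by
    have : t ≤ Data.piSq * t := le_mul_of_one_le_left ht hp
    nlinarith
  have h3 : 0 < β + γ * (Data.piSq * t) := by positivity
  rw [inv_sub_inv (by positivity) h3.ne', abs_div, abs_of_pos (mul_pos (by positivity) h3),
    div_le_div_iff₀ (mul_pos (by positivity) h3) hβ]
  have h4 : β + γ * (Data.piSq * t) - (β + γ * (Real.pi ^ 2 * t)) =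
      -(γ * t * (Real.pi ^ 2 - Data.piSq)) := by ring
  rw [h4, abs_neg, abs_mul, abs_of_nonneg (by positivity)]
  calc γ * t * |Real.pi ^ 2 - (Data.piSq : ℝ)| * β
      ≤ (β + γ * (Data.piSq * t)) * 1e-15 * (β + γ * (Real.pi ^ 2 * t)) := by
        gcongr
        exact abs_piSq_sub_le
    _ = _ := by ring

lemma abs_inv_lamR_sub_le (n : ℕ) : |(lamR n)⁻¹ - ((Data.lam n)⁻¹ : ℚ)| ≤ 1e-15 := by
  have := abs_inv_sub_inv_le (β := 1) (γ := 0.1764) (t := n ^ 2 / 25) (by norm_num) (by norm_num)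
    (by positivity)
  rw [lamR, Data.lam]
  push_cast
  simpa using this

lemma abs_muR_sub_le (n : ℕ) : |muR n - (Data.mu n : ℚ)| ≤ 4e-15 := by
  have := abs_inv_sub_inv_le (β := 0.28) (γ := 1) (t := n ^ 2 / 25) (by norm_num) (by norm_num)
    (by positivity)
  rw [one_mul, one_mul] at this
  have h : muR n - (Data.mu n : ℚ) = -0.950608 * ((0.28 + Real.pi ^ 2 * (n ^ 2 / 25))⁻¹ -
      (0.28 + (Data.piSq : ℝ) * (n ^ 2 / 25))⁻¹) := by
    rw [muR, Data.mu]
    push_cast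
    ring
  rw [h, abs_mul]
  refine (mul_le_mul_of_nonneg_left this (abs_nonneg _)).trans ?_
  norm_num

lemma lamR_pos (n : ℕ) : 0 < lamR n := by unfold lamR; positivity

lemma nine_le_pi_sq : (9 : ℝ) ≤ Real.pi ^ 2 := by nlinarith [Real.pi_gt_three]

lemma abs_inv_lamR_le (n : ℕ) : |(lamR n)⁻¹| ≤ 1 := by
  rw [abs_of_pos (inv_pos.2 (lamR_pos n))]
  refine inv_le_one_of_one_le₀ ?_
  unfold lamR
  exact le_add_of_nonneg_right (by positivity)

lemma abs_muR_le (n : ℕ) : |muR n| ≤ 3.4 := by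
  have h : 0.28 ≤ 0.28 + Real.pi ^ 2 * ((n : ℝ) ^ 2 / 25) := le_add_of_nonneg_right (by positivity)
  rw [muR, abs_div, abs_of_pos (lt_of_lt_of_le (by norm_num) h),
    div_le_iff₀ (lt_of_lt_of_le (by norm_num) h)]
  norm_num at *
  linarith

lemma hundred_le_sq {n : ℕ} (hn : 10 ≤ n) : (4 : ℝ) ≤ n ^ 2 / 25 := by
  have : (10 : ℝ) ≤ n := by exact_mod_cast hn
  nlinarith

lemma abs_inv_lamR_le_of_ten_le {n : ℕ} (hn : 10 ≤ n) : |(lamR n)⁻¹| ≤ 0.14 := by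
  rw [abs_of_pos (inv_pos.2 (lamR_pos n))]
  refine inv_le_of_inv_le₀ (by norm_num) ?_
  unfold lamR
  have := mul_le_mul nine_le_pi_sq (hundred_le_sq hn) (by norm_num) (by positivity)
  norm_num at *
  linarith

lemma abs_muR_le_of_ten_le {n : ℕ} (hn : 10 ≤ n) : |muR n| ≤ 0.1 := by
  have := mul_le_mul nine_le_pi_sq (hundred_le_sq hn) (by norm_num) (by positivity)
  have h : 10 ≤ 0.28 + Real.pi ^ 2 * ((n : ℝ) ^ 2 / 25) := by norm_num at *; linarith
  rw [muR, abs_div, abs_of_pos (lt_of_lt_of_le (by norm_num) h),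
    div_le_iff₀ (lt_of_lt_of_le (by norm_num) h)]
  norm_num at *
  linarith

lemma abs_round6_sub_le (x : ℚ) : |((Data.round6 x : ℚ) : ℝ) - x| ≤ 1e-6 := by
  have h1 := Int.floor_le (x * 10 ^ 6)
  have h : |Data.round6 x - x| ≤ 1e-6 := by
    rw [Data.round6, div_sub' (by norm_num), abs_div, div_le_iff₀ (by norm_num), abs_le]
    norm_num
    norm_num at h1
    constructor
    · have := Int.lt_floor_add_one (x * 1000000)
      linarith
    · linarith
  have h' : ((|Data.round6 x - x| : ℚ) : ℝ) ≤ ((1e-6 : ℚ) : ℝ) := by exact_mod_cast h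
  push_cast at h'
  exact h'

/-- The rational approximation of `1 / λ`. -/
def invLamQ (n : ℕ) : ℝ := ((Data.round6 (Data.lam n)⁻¹ : ℚ) : ℝ)

/-- The rational approximation of `μ`. -/
def muQ (n : ℕ) : ℝ := ((Data.round6 (Data.mu n) : ℚ) : ℝ)

lemma abs_inv_lamR_sub_invLamQ_le (n : ℕ) : |(lamR n)⁻¹ - invLamQ n| ≤ 1.1e-6 := by
  have h := abs_sub_le (lamR n)⁻¹ ((Data.lam n)⁻¹ : ℚ) (invLamQ n)
  have h1 := abs_round6_sub_le (Data.lam n)⁻¹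
  rw [abs_sub_comm] at h1
  have h2 := abs_inv_lamR_sub_le n
  unfold invLamQ at *
  norm_num at *
  linarith

lemma abs_muR_sub_muQ_le (n : ℕ) : |muR n - muQ n| ≤ 1.1e-6 := by
  have h := abs_sub_le (muR n) (Data.mu n : ℚ) (muQ n)
  have h1 := abs_round6_sub_le (Data.mu n)
  rw [abs_sub_comm] at h1
  have h2 := abs_muR_sub_le n
  unfold muQ at *
  norm_num at *
  linarith

lemma abs_le_add_of_abs_sub_le {x y c e : ℝ} (h : |x - y| ≤ e) (hx : |x| ≤ c) : |y| ≤ c + e := by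
  have := abs_sub_abs_le_abs_sub y x
  rw [abs_sub_comm] at this
  linarith

lemma abs_invLamQ_le (n : ℕ) : |invLamQ n| ≤ 1.1 :=
  (abs_le_add_of_abs_sub_le (abs_inv_lamR_sub_invLamQ_le n) (abs_inv_lamR_le n)).trans
    (by norm_num)

lemma abs_muQ_le (n : ℕ) : |muQ n| ≤ 3.5 :=
  (abs_le_add_of_abs_sub_le (abs_muR_sub_muQ_le n) (abs_muR_le n)).trans (by norm_num)

lemma abs_invLamQ_le_of_ten_le {n : ℕ} (hn : 10 ≤ n) : |invLamQ n| ≤ 0.141 :=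
  (abs_le_add_of_abs_sub_le (abs_inv_lamR_sub_invLamQ_le n)
    (abs_inv_lamR_le_of_ten_le hn)).trans (by norm_num)

lemma abs_muQ_le_of_ten_le {n : ℕ} (hn : 10 ≤ n) : |muQ n| ≤ 0.11 :=
  (abs_le_add_of_abs_sub_le (abs_muR_sub_muQ_le n) (abs_muR_le_of_ten_le hn)).trans (by norm_num)

/-! ### Transfer of the numerical checks -/

/-- The inverse of the linear part of the first equation. -/
def opP : Ell101 →L[ℝ] Ell101 := diag (fun n => (lamR n)⁻¹) 1 abs_inv_lamR_le

/-- The linear part of the second component. -/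
def opS : Ell101 →L[ℝ] Ell101 := diag muR 3.4 abs_muR_le

/-- The rational approximation of `opP`. -/
def opPQ : Ell101 →L[ℝ] Ell101 := diag invLamQ 1.1 abs_invLamQ_le

/-- The rational approximation of `opS`. -/
def opSQ : Ell101 →L[ℝ] Ell101 := diag muQ 3.5 abs_muQ_le

variable {σ : ℝ}

/-- The approximate inverse of the linearization. -/
def opA (σ : ℝ) : Ell101 →L[ℝ] Ell101 :=
  perturb 10 fun j => σ ^ j • ofList 1 σ (Data.invCol j)

/-- The approximate linearization on the first ten modes. -/
def opB (σ : ℝ) : Ell101 →L[ℝ] Ell101 :=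
  perturb 10 fun j => σ ^ j • ofList 1 σ (Data.linCol j)

lemma norm_three_le (hσ : σ * σ = 1) {l : List ℚ} {c : ℚ} (h : QList.norm (1.01 ^ 3) l ≤ c) :
    ‖(ofList 3 σ l : Ell101)‖ ≤ c := by
  rw [norm_ofList hσ (t := 1.01 ^ 3) (by norm_num)]
  exact_mod_cast h

lemma norm_pow_smul (hσ : σ * σ = 1) (j : ℕ) (x : Ell101) : ‖σ ^ j • x‖ = ‖x‖ := by
  have hσ' : |σ| = 1 := by
    have : |σ| * |σ| = 1 := by rw [← abs_mul, hσ, abs_one]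
    nlinarith [abs_nonneg σ]
  rw [norm_smul, norm_pow, Real.norm_eq_abs, hσ', one_pow, one_mul]

lemma weight_eq (j : ℕ) : ((Data.weight j : ℚ) : ℝ) = alpha j * 1.01 ^ j := by
  rw [Data.weight, alpha]
  push_cast
  split_ifs <;> norm_num

lemma norm_column_le_weight (hσ : σ * σ = 1) {l : List ℚ} {c : ℚ} {j : ℕ}
    (h : QList.norm 1.01 l ≤ c * Data.weight j) :
    ‖(σ ^ j • ofList 1 σ l : Ell101)‖ ≤ c * (alpha j * 1.01 ^ j) := by
  rw [norm_pow_smul hσ, norm_ofList hσ (t := 1.01) (by norm_num), ← weight_eq]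
  exact_mod_cast h

lemma opA_single_of_ten_le {j : ℕ} (hj : 10 ≤ j) : opA σ (single j) = single j :=
  perturb_of_support fun n hn => by rw [seq_single, if_neg (by omega)]

lemma opB_single_of_ten_le {j : ℕ} (hj : 10 ≤ j) : opB σ (single j) = single j :=
  perturb_of_support fun n hn => by rw [seq_single, if_neg (by omega)]

lemma opA_single (hσ : σ * σ = 1) (j : ℕ) : opA σ (single j) =
    σ ^ j • ofList 1 σ (QList.perturb 10 Data.invCol (QList.single j)) := by
  rw [single_eq_ofList hσ, map_smul, opA, perturb_ofList hσ]

lemma norm_opA_le (hσ : σ * σ = 1) (x : Ell101) : ‖opA σ x‖ ≤ 130 * ‖x‖ := by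
  refine norm_apply_le_of_columns _ (fun j => ?_) x
  rcases lt_or_ge j 10 with hj | hj
  · rw [opA_single hσ]
    exact_mod_cast norm_column_le_weight hσ (Data.norm_inv_le j hj)
  · rw [opA_single_of_ten_le hj, norm_single]
    have := weight_pos (τ := 1.01) j
    linarith

/-- An approximate left inverse is enough: ‖1 − BA‖ ≤ 1/2, so A x = 0 forces ‖x‖ ≤ ‖x‖/2. -/
lemma opA_injective (hσ : σ * σ = 1) (x : Ell101) (hx : opA σ x = 0) : x = 0 := by
  have h := norm_apply_le_of_columns (ContinuousLinearMap.id ℝ _ - (opB σ).comp (opA σ))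
    (q := 0.5) (fun j => ?_) x
  · rw [sub_apply, ContinuousLinearMap.comp_apply, hx, map_zero, sub_zero,
      ContinuousLinearMap.id_apply] at h
    have : ‖x‖ = 0 := by norm_num at h; linarith [norm_nonneg x]
    exact norm_eq_zero.1 this
  · rw [sub_apply, ContinuousLinearMap.comp_apply,
      ContinuousLinearMap.id_apply]
    rcases lt_or_ge j 10 with hj | hj
    · rw [opA_single hσ, map_smul, opB, perturb_ofList hσ, single_eq_ofList hσ, ← smul_sub,
        ← ofList_sub]
      refine (norm_column_le_weight hσ (Data.norm_one_sub_lin_mul_inv_le j hj)).trans_eq ?_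
      norm_num
    · rw [opA_single_of_ten_le hj, opB_single_of_ten_le hj, sub_self, norm_zero]
      have := weight_pos (τ := 1.01) j
      positivity

/-- The preconditioned linearization, with rational entries. -/
def linQ (σ : ℝ) : Ell101 →L[ℝ] Ell101 :=
  ContinuousLinearMap.id ℝ _ - (opA σ).comp (ContinuousLinearMap.id ℝ _ +
    opPQ.comp (ContinuousLinearMap.mul ℝ _ (ofList 3 σ Data.a) +
      (ContinuousLinearMap.mul ℝ _ (ofList 3 σ Data.b)).comp opSQ))

lemma linQ_apply (h : Ell101) : linQ σ h = h - opA σ (h + opPQ (ofList 3 σ Data.a * h +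
    ofList 3 σ Data.b * opSQ h)) := rfl

lemma linQ_single (hσ : σ * σ = 1) (j : ℕ) :
    linQ σ (single j) = σ ^ j • ofList 1 σ (Data.column j) := by
  rw [linQ_apply, opSQ, diag_single, muQ, single_eq_ofList hσ, ← ofList_spread Data.a,
    ← ofList_spread Data.b, smul_comm, mul_smul_comm, mul_smul_comm, mul_smul_comm, ← smul_add,
    ← ofList_mul hσ, ← ofList_mul hσ, ← ofList_mulSingle, ← ofList_mulSingle, ← ofList_smul,
    ← ofList_add, map_smul, opPQ,
    diag_ofList (r := fun n => Data.round6 (Data.lam n)⁻¹) _ (fun i => by rw [invLamQ, one_mul]),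
    ← smul_add, ← ofList_add, map_smul, opA, perturb_ofList hσ, ← smul_sub, ← ofList_sub]
  rfl

lemma norm_a_le (hσ : σ * σ = 1) : ‖(ofList 3 σ Data.a : Ell101)‖ ≤ 2.2 :=
  (norm_three_le hσ Data.norm_a_le).trans_eq (by norm_num)

lemma norm_b_le (hσ : σ * σ = 1) : ‖(ofList 3 σ Data.b : Ell101)‖ ≤ 1.3 :=
  (norm_three_le hσ Data.norm_b_le).trans_eq (by norm_num)

lemma seq_ofList_three_eq_zero {l : List ℚ} (hl : l.length = 4) {n : ℕ} (hn : 10 ≤ n) :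
    (ofList 3 σ l : Ell101).seq n = 0 := by
  rw [seq_ofList]
  split_ifs with h
  · rw [QList.get_of_length_le (by omega), Rat.cast_zero, mul_zero]
  · rfl

lemma norm_linQ_single_le (hσ : σ * σ = 1) (j : ℕ) :
    ‖linQ σ (single j)‖ ≤ 0.35 * (alpha j * 1.01 ^ j) := by
  rcases lt_or_ge j 19 with hj | hj
  · rw [linQ_single hσ]
    refine (norm_column_le_weight hσ (Data.norm_column_le j hj)).trans_eq ?_
    norm_num
  -- For j ≥ 19 the products live in modes ≥ j − 9 ≥ 10, where A is the identity. Only −P y remains,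
  -- of relative size 0.141 · (2.2 + 1.3 · 0.11) < 0.35.
  · set y : Ell101 := ofList 3 σ Data.a * single j + ofList 3 σ Data.b * opSQ (single j) with hy
    have hsupp : ∀ n < 10, y.seq n = 0 := fun n hn => by
      rw [hy, opSQ, diag_single, mul_smul_comm, seq_add, seq_smul, Pi.add_apply, Pi.smul_apply,
        seq_mul_single_eq_zero (d := 10) (N := 10) (fun m hm => seq_ofList_three_eq_zero rfl hm)
          (by omega) hn,
        seq_mul_single_eq_zero (d := 10) (N := 10) (fun m hm => seq_ofList_three_eq_zero rfl hm)
          (by omega) hn, smul_zero, add_zero]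
    have hA : opA σ (single j + opPQ y) = single j + opPQ y := perturb_of_support fun n hn => by
      rw [seq_add, Pi.add_apply, opPQ, seq_diag, hsupp n hn, mul_zero, add_zero, seq_single,
        if_neg (by omega)]
    rw [linQ_apply, ← hy, hA, sub_add_cancel_left, norm_neg]
    have h1 : ‖opPQ y‖ ≤ 0.141 * ‖y‖ :=
      norm_diag_le_of_support _ (fun n hn => abs_invLamQ_le_of_ten_le hn) hsupp
    have h2 : ‖opSQ (single j)‖ ≤ 0.11 * ‖(single j : Ell101)‖ := by
      rw [opSQ, diag_single, norm_smul, Real.norm_eq_abs]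
      exact mul_le_mul_of_nonneg_right (abs_muQ_le_of_ten_le (by omega)) (norm_nonneg _)
    have h3 : ‖y‖ ≤ 2.2 * ‖(single j : Ell101)‖ + 1.3 * (0.11 * ‖(single j : Ell101)‖) :=
      norm_add_le_of_le (norm_mul_le_of_le (norm_a_le hσ) le_rfl)
        (norm_mul_le_of_le (norm_b_le hσ) h2)
    rw [← norm_single]
    have := norm_nonneg (single j : Ell101)
    linarith

/-- Rounding the diagonal factors to six digits costs about 1e-6, which even after amplification by
130 fits between 0.35 and 0.4. -/
lemma norm_linear_le (hσ : σ * σ = 1) (h : Ell101) :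
    ‖h - opA σ (h + opP (ofList 3 σ Data.a * h + ofList 3 σ Data.b * opS h))‖ ≤ 0.4 * ‖h‖ := by
  have h1 : h - opA σ (h + opP (ofList 3 σ Data.a * h + ofList 3 σ Data.b * opS h)) =
      linQ σ h - opA σ ((opP (ofList 3 σ Data.a * h + ofList 3 σ Data.b * opS h) -
        opPQ (ofList 3 σ Data.a * h + ofList 3 σ Data.b * opS h)) +
        opPQ (ofList 3 σ Data.b * (opS h - opSQ h))) := by
    rw [linQ_apply, mul_sub]
    simp only [map_add, map_sub]
    abel
  have h2 := norm_apply_le_of_columns (linQ σ) (norm_linQ_single_le hσ) h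
  have h3 : ‖ofList 3 σ Data.a * h + ofList 3 σ Data.b * opS h‖ ≤
      2.2 * ‖h‖ + 1.3 * (3.4 * ‖h‖) :=
    norm_add_le_of_le (norm_mul_le_of_le (norm_a_le hσ) le_rfl)
      (norm_mul_le_of_le (norm_b_le hσ) (norm_diag_le _ _))
  have h4 := (norm_diag_sub_le abs_inv_lamR_le abs_invLamQ_le abs_inv_lamR_sub_invLamQ_le _).trans
    (mul_le_mul_of_nonneg_left h3 (by norm_num))
  have h5 := (norm_diag_le abs_invLamQ_le _).trans (mul_le_mul_of_nonneg_left
    (norm_mul_le_of_le (norm_b_le hσ) (norm_diag_sub_le abs_muR_le abs_muQ_le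
      abs_muR_sub_muQ_le h)) (by norm_num))
  rw [h1]
  refine (norm_sub_le_of_le h2 ((norm_opA_le hσ _).trans
    (mul_le_mul_of_nonneg_left (norm_add_le_of_le h4 h5) (by norm_num)))).trans ?_
  have := norm_nonneg h
  linarith

lemma eight_mul_eq (x : Ell101) : 8 * x = (8 : ℝ) • x := by
  rw [Algebra.smul_def, map_ofNat]

/-- `w` is defined as 21 − Λu with rational Λ, so only the error of π² remains here; the genuine
residual sits in `norm_residual`. -/
lemma norm_residual_fst_le (hσ : σ * σ = 1) :
    ‖(ofList 3 σ Data.u : Ell101) - opP (21 - ofList 3 σ Data.w)‖ ≤ 1e-13 := by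
  have hs : ∀ n, |(((Data.lam n)⁻¹ : ℚ) : ℝ)| ≤ 1 + 1e-15 := fun n =>
    abs_le_add_of_abs_sub_le (abs_inv_lamR_sub_le n) (abs_inv_lamR_le n)
  have h1 : (21 : Ell101) - ofList 3 σ Data.w = ofList 3 σ Data.lamU := by
    simp only [Data.w, ofList_sub, ofList_smul, ofList_one, Algebra.smul_def]
    push_cast
    simp only [map_ofNat]
    ring
  have h2 : (ofList 3 σ Data.u : Ell101) = diag _ _ hs (ofList 3 σ Data.lamU) := by
    rw [diag_ofList (r := fun i => (Data.lam (3 * i))⁻¹) _ (fun i => rfl)]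
    ext n
    have h3 : Data.lam (3 * (n / 3)) ≠ 0 := by
      rw [Data.lam, Data.piSq]
      positivity
    rw [seq_ofList, seq_ofList, QList.get_diag, Data.lamU, QList.get_diag, inv_mul_cancel_left₀ h3]
  rw [h1, h2, opP, norm_sub_rev]
  refine (norm_diag_sub_le _ _ abs_inv_lamR_sub_le _).trans ?_
  have := norm_three_le hσ Data.norm_lamU_le
  norm_num at *
  linarith

lemma norm_residual_snd_le (hσ : σ * σ = 1) : ‖opS (ofList 3 σ Data.u) +
    algebraMap ℝ Ell101 Data.kap - ofList 3 σ Data.v‖ ≤ 1e-13 := by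
  have hs : ∀ n, |((Data.mu n : ℚ) : ℝ)| ≤ 3.4 + 4e-15 := fun n =>
    abs_le_add_of_abs_sub_le (abs_muR_sub_le n) (abs_muR_le n)
  have h1 : (ofList 3 σ (QList.sub (QList.add (QList.diag (fun i => Data.mu (3 * i)) Data.u)
      (QList.smul Data.kap [1])) Data.v) : Ell101) = diag _ _ hs (ofList 3 σ Data.u) +
      algebraMap ℝ Ell101 Data.kap - ofList 3 σ Data.v := by
    rw [diag_ofList (r := fun i => Data.mu (3 * i)) _ (fun i => rfl), ofList_sub, ofList_add,
      ofList_smul, ofList_one, Algebra.smul_def, mul_one]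
  have h2 := norm_three_le hσ Data.norm_residual_snd_le
  rw [h1] at h2
  have h3 := norm_diag_sub_le abs_muR_le hs abs_muR_sub_le (ofList 3 σ Data.u : Ell101)
  have h4 := norm_three_le hσ Data.norm_u_le
  have h5 : opS (ofList 3 σ Data.u) + algebraMap ℝ Ell101 Data.kap - ofList 3 σ Data.v =
      (diag muR 3.4 abs_muR_le (ofList 3 σ Data.u) - diag _ _ hs (ofList 3 σ Data.u)) +
      (diag _ _ hs (ofList 3 σ Data.u) + algebraMap ℝ Ell101 Data.kap - ofList 3 σ Data.v) := by
    rw [opS]; abel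
  rw [h5]
  refine (norm_add_le_of_le h3 h2).trans ?_
  norm_num at *
  linarith

/-- The approximate solution. -/
def approx (σ : ℝ) (hσ : σ * σ = 1) : ApproxSolution Ell101 where
  m := algebraMap ℝ _ 1.4112
  κ := algebraMap ℝ _ Data.kap
  P := opP
  S := opS
  A := opA σ
  u := ofList 3 σ Data.u
  v := ofList 3 σ Data.v
  w := ofList 3 σ Data.w
  a := ofList 3 σ Data.a
  b := ofList 3 σ Data.b
  k := algebraMap ℝ _ 0.0245
  norm_m := by rw [norm_algebraMap']; norm_num
  norm_P := norm_diag_le _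
  norm_S := norm_diag_le _
  norm_A := norm_opA_le hσ
  norm_u := (norm_three_le hσ Data.norm_u_le).trans_eq (by norm_num)
  norm_v := (norm_three_le hσ Data.norm_v_le).trans_eq (by norm_num)
  norm_w := (norm_three_le hσ Data.norm_w_le).trans_eq (by norm_num)
  norm_a := norm_a_le hσ
  norm_b := norm_b_le hσ
  norm_k := by rw [norm_algebraMap']; norm_num
  norm_one_sub := by
    refine le_trans (le_of_eq ?_) ((norm_three_le hσ Data.norm_one_sub_le).trans_eq (by norm_num))
    congr 1
    simp only [Data.den, ofList_sub, ofList_add, ofList_smul, ofList_mul hσ, ofList_one,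
      Algebra.smul_def]
    norm_num
  norm_residual := by
    refine le_trans (le_of_eq ?_) ((norm_three_le hσ Data.norm_residual_le).trans_eq (by norm_num))
    congr 1
    simp only [Data.den, ofList_sub, ofList_add, ofList_smul, ofList_mul hσ, ofList_one,
      Algebra.smul_def]
    push_cast
    simp only [map_ofNat]
  norm_residual_fst := norm_residual_fst_le hσ
  norm_residual_snd := norm_residual_snd_le hσ
  norm_residual_a := by
    refine le_trans (le_of_eq ?_)
      ((norm_three_le hσ Data.norm_residual_a_le).trans_eq (by norm_num))
    congr 1
    have h : (algebraMap ℝ Ell101 2.8224) = 2 * algebraMap ℝ Ell101 1.4112 := by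
      rw [← map_ofNat (algebraMap ℝ Ell101), ← map_mul]
      norm_num
    simp only [Data.den, ofList_sub, ofList_add, ofList_smul, ofList_mul hσ, ofList_one,
      Algebra.smul_def]
    push_cast
    simp only [map_ofNat, h]
  norm_residual_b := by
    refine le_trans (le_of_eq ?_)
      ((norm_three_le hσ Data.norm_residual_b_le).trans_eq (by norm_num))
    congr 1
    simp only [Data.den, ofList_sub, ofList_add, ofList_smul, ofList_mul hσ, ofList_one,
      Algebra.smul_def]
    push_cast
    simp only [map_ofNat]
  norm_linear := norm_linear_le hσ
  injective := opA_injective hσ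

end

end Thomas

namespace Thomas

noncomputable section

open Ell

/-! ### Translation of the equation into the Banach algebra -/

lemma isConvInv_inverse {φ : Ell101} (h : IsUnit φ) : IsConvInv 1.01 φ.seq (Ring.inverse φ).seq :=
  ⟨memEll _, by rw [← seq_mul, Ring.mul_inverse_cancel φ h, seq_one]⟩

/-- The choice in `convInv` is harmless because inverses are unique. -/
lemma convInv_seq {φ : Ell101} (h : IsUnit φ) : convInv 1.01 φ.seq = (Ring.inverse φ).seq := by
  have hc : ConvInvertible 1.01 φ.seq := ⟨_, isConvInv_inverse h⟩
  rw [convInv, dif_pos hc]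
  have h1 : φ * mk hc.choose hc.choose_spec.1 = 1 := Ell.ext hc.choose_spec.2
  have h2 : mk hc.choose hc.choose_spec.1 = Ring.inverse φ := by
    linear_combination (-mk hc.choose hc.choose_spec.1) * Ring.mul_inverse_cancel φ h
      + Ring.inverse φ * h1
  rw [← h2, seq_mk]

/-- The parameters of the theorem. -/
def params : Params := ⟨0.1764, 8, 1, 0.28, 21, 67.46981860371494, 5, 1.01⟩

lemma denom_seq (x y : Ell101) : denom params (x.seq, y.seq) = (ApproxSolution.den x).seq := by
  simp [denom, params, ApproxSolution.den, seq_one, seq_mul]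

lemma numer_seq (x y : Ell101) : numer params (x.seq, y.seq) =
    (algebraMap ℝ Ell101 1.4112 * (x * x) - 8 * (x * y)).seq := by
  rw [eight_mul_eq, ← Algebra.smul_def]
  simp only [numer, params, seq_sub, seq_smul, seq_mul]
  norm_num

variable {σ : ℝ} (hσ : σ * σ = 1)

lemma seq_algebraMap (c : ℝ) (n : ℕ) : (algebraMap ℝ Ell101 c).seq n = c * e0 n := by
  rw [Algebra.algebraMap_eq_smul_one, seq_smul, seq_one, Pi.smul_apply, smul_eq_mul]

/-- Entry by entry, this is division by ν₃ + (πn/d)² > 0. -/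
lemma Fp_snd_eq_zero_iff (x y : Ell101) :
    (Fp params (x.seq, y.seq)).2 = 0 ↔ y = (approx σ hσ).snd x := by
  rw [Ell.ext_iff, funext_iff, funext_iff]
  refine forall_congr' fun n => ?_
  have hpos : 0 < 0.28 + Real.pi ^ 2 * ((n : ℝ) ^ 2 / 25) := by positivity
  have hk : ((Data.kap : ℚ) : ℝ) * e0 n * (0.28 + Real.pi ^ 2 * ((n : ℝ) ^ 2 / 25)) =
      (-0.28 * 67.46981860371494 + 21) * e0 n := by
    rw [Data.kap, e0]
    split_ifs with h
    · subst h; norm_num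
    · simp
  have h1 : (Fp params (x.seq, y.seq)).2 n = -0.950608 * x.seq n
      - (0.28 + Real.pi ^ 2 * ((n : ℝ) ^ 2 / 25)) * y.seq n
      + (-0.28 * 67.46981860371494 + 21) * e0 n := by
    simp only [Fp, Lp, Gp, lap, params, Prod.snd_add, Pi.add_apply, Pi.sub_apply, Pi.smul_apply,
      smul_eq_mul]
    ring
  have h2 : ((approx σ hσ).snd x).seq n = muR n * x.seq n + Data.kap * e0 n := by
    rw [← seq_algebraMap]; rfl
  have h3 : muR n * (0.28 + Real.pi ^ 2 * ((n : ℝ) ^ 2 / 25)) = -0.950608 := by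
    rw [muR, div_mul_cancel₀ _ hpos.ne']
  rw [h1, h2, Pi.zero_apply]
  constructor
  · intro h
    refine mul_right_cancel₀ hpos.ne' ?_
    linear_combination -h - x.seq n * h3 - hk
  · intro h
    rw [h]
    linear_combination -x.seq n * h3 - hk

lemma Fp_fst_eq_zero_iff {x y : Ell101} (h : IsUnit (ApproxSolution.den x))
    (hy : y = (approx σ hσ).snd x) :
    (Fp params (x.seq, y.seq)).1 = 0 ↔ x = (approx σ hσ).rhs x := by
  rw [Ell.ext_iff, funext_iff, funext_iff]
  refine forall_congr' fun n => ?_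
  have h1 : (Fp params (x.seq, y.seq)).1 n = -(lamR n * x.seq n)
      + (21 * e0 n - ((approx σ hσ).quot x).seq n) := by
    have h2 : ((approx σ hσ).quot x).seq = conv (numer params (x.seq, y.seq))
        (convInv params.τ (denom params (x.seq, y.seq))) := by
      rw [numer_seq, denom_seq, hy]
      change _ = conv _ (convInv 1.01 _)
      rw [convInv_seq h]
      rfl
    rw [h2]
    simp only [Fp, Lp, Gp, gp, lap, params, lamR, Prod.fst_add, Pi.add_apply, Pi.sub_apply,
      Pi.smul_apply, smul_eq_mul]
    ring
  have h3 : ((approx σ hσ).rhs x).seq n =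
      (lamR n)⁻¹ * (21 * e0 n - ((approx σ hσ).quot x).seq n) := by
    rw [← seq_algebraMap, map_ofNat]; rfl
  have hpos := lamR_pos n
  rw [h1, h3, Pi.zero_apply, neg_add_eq_zero, eq_inv_mul_iff_mul_eq₀ hpos.ne']

lemma Fp_eq_zero_iff {x y : Ell101} (h : IsUnit (ApproxSolution.den x)) :
    Fp params (x.seq, y.seq) = 0 ↔ y = (approx σ hσ).snd x ∧ x = (approx σ hσ).rhs x := by
  rw [Prod.ext_iff, and_comm, Prod.snd_zero, Prod.fst_zero, Fp_snd_eq_zero_iff hσ]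
  exact and_congr_right fun hy => Fp_fst_eq_zero_iff hσ h hy

lemma ofThirds_map (σ : ℝ) (l : List ℚ) : ofThirds σ (l.map fun q : ℚ => (q : ℝ)) = dilSeq 3 σ l := by
  funext n
  have h : (l.map fun q : ℚ => (q : ℝ)).getD (n / 3) 0 = (QList.get l (n / 3) : ℝ) := by
    rw [QList.get, ← Rat.cast_zero (α := ℝ), List.getD_map]
  rw [ofThirds, dilSeq, h]

lemma center_fst (σ : ℝ) : (center σ).1 = (ofList 3 σ Data.u₀ : Ell101).seq := by
  have h : centerList₁ = Data.u₀.map fun q : ℚ => (q : ℝ) := by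
    simp only [centerList₁, Data.u₀, List.map_cons, List.map_nil]
    norm_num
  rw [center, h, ofThirds_map]
  rfl

lemma center_snd (σ : ℝ) : (center σ).2 = (ofList 3 σ Data.v : Ell101).seq := by
  have h : centerList₂ = Data.v.map fun q : ℚ => (q : ℝ) := by
    simp only [centerList₂, Data.v, List.map_cons, List.map_nil]
    norm_num
  rw [center, h, ofThirds_map]
  rfl

include hσ in
lemma norm_u_sub_center_le : ‖(ofList 3 σ Data.u : Ell101) - ofList 3 σ Data.u₀‖ ≤ 1e-12 := by
  rw [← ofList_sub]
  exact (norm_three_le hσ Data.norm_sub_center_le).trans_eq (by norm_num)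

/-- Membership in a ball in terms of the norm of `ℓ¹_τ(ℕ₀)`. -/
lemma mem_closedBallE_iff {x y c d : Ell101} {r : ℝ} :
    (x.seq, y.seq) ∈ closedBallE 1.01 (c.seq, d.seq) r ↔ ‖x - c‖ + ‖y - d‖ ≤ r :=
  ⟨fun h => h.2, fun h => ⟨⟨x.memEll, y.memEll⟩, h⟩⟩

lemma exists_seq_eq {U : Coeffs × Coeffs} (h : MemEllE 1.01 U) :
    ∃ x y : Ell101, U = (x.seq, y.seq) :=
  ⟨mk U.1 h.1, mk U.2 h.2, rfl⟩

-- The given ball lies in the uniqueness ball of u, as 5e-9 + 1e-9 + 1e-12 < 1e-8. It contains the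
-- solution, since the two components differ from `u` and `v` by at most 2e-10 and 1e-9, and the
-- shifts of the centre add only 1e-12 + 1e-9.
include hσ in
theorem existsUnique_zero {R : ℝ} (hR : R = 5e-9) {c d : Ell101}
    (hc : ‖c - ofList 3 σ Data.u₀‖ + ‖d - ofList 3 σ Data.v‖ ≤ 1e-9) :
    (∀ U ∈ closedBallE 1.01 (c.seq, d.seq) R, ConvInvertible 1.01 (denom params U)) ∧
      ∃! U : Coeffs × Coeffs, U ∈ closedBallE 1.01 (c.seq, d.seq) R ∧ Fp params U = 0 := by
  subst hR
  set X := approx σ hσ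
  have hu := norm_u_sub_center_le hσ
  have hball : ∀ {x y : Ell101}, (x.seq, y.seq) ∈ closedBallE 1.01 (c.seq, d.seq) 5e-9 →
      ‖x - X.u‖ ≤ 1e-8 := fun {x y} h => by
    rw [mem_closedBallE_iff] at h
    have h1 : x - X.u = (x - c) + (c - ofList 3 σ Data.u₀)
        - (ofList 3 σ Data.u - ofList 3 σ Data.u₀) := by
      change x - ofList 3 σ Data.u = _
      abel
    rw [h1]
    have h2 := norm_sub_le_of_le (norm_add_le (x - c) (c - ofList 3 σ Data.u₀)) hu
    have := norm_nonneg (y - d)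
    have := norm_nonneg (d - ofList 3 σ Data.v)
    norm_num at hc h h2 ⊢
    linarith
  refine ⟨fun U hU => ?_, ?_⟩
  · obtain ⟨x, y, rfl⟩ := exists_seq_eq hU.1
    rw [denom_seq]
    exact ⟨_, isConvInv_inverse (ApproxSolution.isUnit_den (hball hU))⟩
  · obtain ⟨x, hx, hfix⟩ := X.exists_eq_rhs
    have hx' : ‖x - X.u‖ ≤ 1e-8 := hx.trans (by norm_num)
    have hsnd : ‖X.snd x - ofList 3 σ Data.v‖ ≤ 1e-9 := by
      have h1 : X.snd x - ofList 3 σ Data.v = X.S (x - X.u) + (X.S X.u + X.κ - X.v) := by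
        change X.snd x - X.v = _
        simp only [ApproxSolution.snd, map_sub]; abel
      rw [h1]
      exact (norm_add_le_of_le ((X.norm_S _).trans (mul_le_mul_of_nonneg_left hx (by norm_num)))
        X.norm_residual_snd).trans (by norm_num)
    refine ⟨(x.seq, (X.snd x).seq), ⟨?_, ?_⟩, ?_⟩
    · rw [mem_closedBallE_iff]
      have h1 : x - c = (x - ofList 3 σ Data.u) + (ofList 3 σ Data.u - ofList 3 σ Data.u₀)
        - (c - ofList 3 σ Data.u₀) := by abel
      have h2 : X.snd x - d = (X.snd x - ofList 3 σ Data.v) - (d - ofList 3 σ Data.v) := by abel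
      have h3 := norm_sub_le_of_le (norm_add_le_of_le hx hu) (le_refl ‖c - ofList 3 σ Data.u₀‖)
      have h4 := norm_sub_le_of_le hsnd (le_refl ‖d - ofList 3 σ Data.v‖)
      have h5 : ‖x - c‖ ≤ 2e-10 + 1e-12 + ‖c - ofList 3 σ Data.u₀‖ := by rw [h1]; exact h3
      rw [← h2] at h4
      norm_num at *
      linarith
    · exact (Fp_eq_zero_iff hσ (ApproxSolution.isUnit_den hx')).2 ⟨rfl, hfix⟩
    · rintro U ⟨hU, hzero⟩
      obtain ⟨x', y', rfl⟩ := exists_seq_eq hU.1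
      obtain ⟨rfl, hfix'⟩ :=
        (Fp_eq_zero_iff hσ (ApproxSolution.isUnit_den (hball hU))).1 hzero
      -- The second component is a function of the first, so uniqueness of the first is enough.
      rw [X.eq_of_eq_rhs (hball hU) hx' hfix' hfix]

end

end Thomas

/-- The exact output of the numerical construction of the approximate solution enters only through
the requirement that it is within `10⁻⁹` of the explicit sequence `center σ`. -/
theorem mainTheorem6 (p : Thomas.Params)
    (hν : p.ν = 0.1764) (hν₁ : p.ν₁ = 8) (hν₂ : p.ν₂ = 1) (hν₃ : p.ν₃ = 0.28)
    (hν₄ : p.ν₄ = 21) (hν₅ : p.ν₅ = 67.46981860371494) (hd : p.d = 5) (hτ : p.τ = 1.01)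
    (R : ℝ) (hR : R = 5 * (10 : ℝ) ^ (-9 : ℤ))
    (σ : ℝ) (hσ : σ = 1 ∨ σ = -1)
    (Ubar : (ℕ → ℝ) × (ℕ → ℝ))
    (hU : Ubar ∈ Thomas.closedBallE p.τ (Thomas.center σ) ((10 : ℝ) ^ (-9 : ℤ))) :
    (∀ U ∈ Thomas.closedBallE p.τ Ubar R, Thomas.ConvInvertible p.τ (Thomas.denom p U)) ∧
      ∃! U : (ℕ → ℝ) × (ℕ → ℝ), U ∈ Thomas.closedBallE p.τ Ubar R ∧ Thomas.Fp p U = 0 := by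
  obtain ⟨ν, ν₁, ν₂, ν₃, ν₄, ν₅, d, τ⟩ := p
  dsimp only at hν hν₁ hν₂ hν₃ hν₄ hν₅ hd hτ
  subst hν hν₁ hν₂ hν₃ hν₄ hν₅ hd hτ
  have hσ' : σ * σ = 1 := by rcases hσ with rfl | rfl <;> norm_num
  obtain ⟨x, y, rfl⟩ := Thomas.exists_seq_eq hU.1
  have hc : Thomas.center σ = ((Thomas.Ell.ofList 3 σ Thomas.Data.u₀ : Thomas.Ell101).seq,
      (Thomas.Ell.ofList 3 σ Thomas.Data.v : Thomas.Ell101).seq) :=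
    Prod.ext (Thomas.center_fst σ) (Thomas.center_snd σ)
  rw [hc, Thomas.mem_closedBallE_iff] at hU
  exact Thomas.existsUnique_zero hσ' (hR.trans (by norm_num)) (hU.trans (by norm_num))
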